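/- Let $\Bbbk$ be a field and $H$ a finite-dimensional Hopf algebra over $\Bbbk$. Let $R$ and $S$ be left $H$-comodule algebras with coactions $r\mapsto r_{(-1)}\otimes r_{(0)}$ and $s\mapsto s_{(-1)}\otimes s_{(0)}$, with $R$ finite-dimensional. Write $\operatorname{Rep}H$, ${}_R\mathcal M$, ${}_S\mathcal M$ for the categories of finite-dimensional left modules over $H$, $R$, $S$. Then ${}_R\mathcal M$ is a module category over $\operatorname{Rep}H$ by $X\otimes V:=X\otimes_{\Bbbk}V$ with $r(x\otimes v)=r_{(-1)}x\otimes r_{(0)}v$, and similarly for ${}_S\mathcal M$. A module functor $(F,c)\colon{}_R\mathcal M\to{}_S\mathcal M$ is a $\Bbbk$-linear functor $F$ with natural isomorphisms $c_{X,V}\colon F(X\otimes V)\to X\otimes F(V)$ that are compatible with the associativity and unit constraints. A morphism $(F,c)\to(G,d)$ is a natural transformation $\alpha\colon F\to G$ with $d_{X,V}\,\alpha_{X\otimes V}=(\mathrm{id}_X\otimes\alpha_V)\,c_{X,V}$. These form the category $\operatorname{Hom}_{\operatorname{Rep}H}({}_R\mathcal M,{}_S\mathcal M)$. An equivariant $(S,R)$-bimodule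 is a finite-dimensional $(S,R)$-bimodule $P$ with a left $H$-comodule structure $P\to H\otimes_{\Bbbk}P$, $p\mapsto p_{(-1)}\otimes p_{(0)}$, that is a map of $(S,R)$-bimodules for $s(h\otimes p)r=s_{(-1)}hr_{(-1)}\otimes s_{(0)}pr_{(0)}$. Morphisms are the maps of bimodules that are also maps of $H$-comodules. Let ${}^H_S\mathcal M_R$ be the category of equivariant $(S,R)$-bimodules. There is a functor ${}^H_S\mathcal M_R\to\operatorname{Hom}_{\operatorname{Rep}H}({}_R\mathcal M,{}_S\mathcal M)$ that maps $P$ to the functor $P\otimes_R-$ with the constraint $$c_{X,V}(p\otimes_R(x\otimes v))=p_{(-1)}x\otimes(p_{(0)}\otimes_R v),$$ and a morphism $f$ to the natural transformation $f\otimes\mathrm{id}$. Its values are right exact functors, and 1. it is an equivalence from ${}^H_S\mathcal M_R$ to the full subcategory of the right exact module functors in $\operatorname{Hom}_{\operatorname{Rep}H}({}_R\mathcal M,{}_S\mathcal M)$; 2. if $R$ is exact, that is, if $X\otimes M$ is projective for all projective $X\in\operatorname{Rep}H$ and all $M\in{}_R\mathcal M$, then it is an equivalence $${}^H_S\mathcal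 M_R\simeq\operatorname{Hom}_{\operatorname{Rep}H}({}_R\mathcal M,{}_S\mathcal M).$$ -/

import Mathlib

open CategoryTheory MonoidalCategory TensorProduct

open scoped MonoidalLeftAction

universe u

/-! ## Finite-dimensional modules over an algebra -/

/-- A finite-dimensional left module over the `k`-algebra `A`: a finite-dimensional `k`-vector
space with an action of `A` by `k`-linear endomorphisms, given as a homomorphism of
(unital) `k`-algebras `A → End_k V`. -/
structure FDMod (k : Type u) [Field k] (A : Type u) [Ring A] [Algebra k A] where
  V : Type u
  [addCommGroup : AddCommGroup V]
  [module : Module k V]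
  [finite : Module.Finite k V]
  /-- the action of `A` -/
  act : A →ₐ[k] Module.End k V

namespace FDMod

attribute [instance] FDMod.addCommGroup FDMod.module FDMod.finite

section Category

variable {k : Type u} [Field k] {A : Type u} [Ring A] [Algebra k A]

/-- Morphisms of `A`-modules: the `A`-linear maps. -/
@[ext]
structure Hom (X Y : FDMod k A) where
  lin : X.V →ₗ[k] Y.V
  comm : ∀ (a : A) (x : X.V), lin (X.act a x) = Y.act a (lin x)

instance : Category (FDMod k A) where
  Hom X Y := Hom X Y
  id X := ⟨LinearMap.id, fun _ _ => rfl⟩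
  comp f g := ⟨g.lin ∘ₗ f.lin, fun a x => by simp [f.comm, g.comm]⟩

variable {X Y Z : FDMod k A}

@[ext]
theorem hom_ext {f g : X ⟶ Y} (h : f.lin = g.lin) : f = g := Hom.ext h

@[simp] theorem id_lin : Hom.lin (𝟙 X) = LinearMap.id := rfl

@[simp] theorem comp_lin (f : X ⟶ Y) (g : Y ⟶ Z) : (f ≫ g).lin = g.lin ∘ₗ f.lin := rfl

instance : Zero (X ⟶ Y) := ⟨⟨0, fun a x => by simp⟩⟩

instance : Add (X ⟶ Y) := ⟨fun f g => ⟨f.lin + g.lin, fun a x => by simp [f.comm, g.comm]⟩⟩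

instance : Neg (X ⟶ Y) := ⟨fun f => ⟨-f.lin, fun a x => by simp [f.comm]⟩⟩

instance : Sub (X ⟶ Y) := ⟨fun f g => ⟨f.lin - g.lin, fun a x => by simp [f.comm, g.comm]⟩⟩

instance : SMul k (X ⟶ Y) := ⟨fun c f => ⟨c • f.lin, fun a x => by simp [f.comm]⟩⟩

instance : SMul ℕ (X ⟶ Y) := ⟨fun c f => ⟨c • f.lin, fun a x => by simp [f.comm]⟩⟩

instance : SMul ℤ (X ⟶ Y) := ⟨fun c f => ⟨c • f.lin, fun a x => by simp [f.comm]⟩⟩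

theorem lin_injective : Function.Injective (fun f : X ⟶ Y => f.lin) := fun _ _ h => hom_ext h

instance : AddCommGroup (X ⟶ Y) :=
  lin_injective.addCommGroup _ rfl (fun _ _ => rfl) (fun _ => rfl) (fun _ _ => rfl)
    (fun _ _ => rfl) (fun _ _ => rfl)

@[simp] theorem zero_lin : Hom.lin (0 : X ⟶ Y) = 0 := rfl

@[simp] theorem add_lin (f g : X ⟶ Y) : (f + g).lin = f.lin + g.lin := rfl

@[simp] theorem smul_lin (c : k) (f : X ⟶ Y) : (c • f).lin = c • f.lin := rfl

instance : Module k (X ⟶ Y) :=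
  lin_injective.module k ⟨⟨fun f : X ⟶ Y => f.lin, rfl⟩, fun _ _ => rfl⟩ (fun _ _ => rfl)

instance : Preadditive (FDMod k A) where
  add_comp _ _ _ _ _ _ := by ext; simp
  comp_add _ _ _ _ _ _ := by ext; simp

instance : Linear k (FDMod k A) where
  smul_comp _ _ _ _ _ _ := by ext; simp
  comp_smul _ _ _ _ _ _ := by ext; simp

/-- A bijective linear map that commutes with the actions is an isomorphism of modules. -/
def isoMk (e : X.V ≃ₗ[k] Y.V) (h : ∀ (a : A) (x : X.V), e (X.act a x) = Y.act a (e x)) :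
    X ≅ Y where
  hom := ⟨e.toLinearMap, h⟩
  inv := ⟨e.symm.toLinearMap, fun a y => by
    apply e.injective
    simp [h]⟩
  hom_inv_id := by ext; simp
  inv_hom_id := by ext; simp

@[simp] theorem isoMk_hom_lin (e : X.V ≃ₗ[k] Y.V) (h) :
    (isoMk (X := X) (Y := Y) e h).hom.lin = e.toLinearMap := rfl

@[simp] theorem isoMk_inv_lin (e : X.V ≃ₗ[k] Y.V) (h) :
    (isoMk (X := X) (Y := Y) e h).inv.lin = e.symm.toLinearMap := rfl

end Category

end FDMod

/-! ## Tensor products of actions -/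

section PairAct

variable {k : Type u} [Field k]

/-- Given linear actions of `A` on `X` and of `B` on `V`, the action of `A ⊗ B` on `X ⊗ V` with
`(a ⊗ b) (x ⊗ v) = a x ⊗ b v`. -/
noncomputable def pairAct {A B X V : Type u} [AddCommGroup A] [Module k A]
    [AddCommGroup B] [Module k B] [AddCommGroup X] [Module k X] [AddCommGroup V] [Module k V]
    (φ : A →ₗ[k] Module.End k X) (ψ : B →ₗ[k] Module.End k V) :
    A ⊗[k] B →ₗ[k] Module.End k (X ⊗[k] V) :=
  TensorProduct.lift
    { toFun := fun a =>
        { toFun := fun b => TensorProduct.map (φ a) (ψ b)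
          map_add' := fun b b' => by rw [map_add, TensorProduct.map_add_right]
          map_smul' := fun c b => by rw [map_smul, TensorProduct.map_smul_right]; rfl }
      map_add' := fun a a' => by
        ext b : 1
        exact (congrArg (fun f => TensorProduct.map f (ψ b)) (map_add φ a a')).trans
          (TensorProduct.map_add_left _ _ _)
      map_smul' := fun c a => by
        ext b : 1
        exact (congrArg (fun f => TensorProduct.map f (ψ b)) (map_smul φ c a)).trans
          (TensorProduct.map_smul_left _ _ _) }

@[simp] theorem pairAct_tmul {A B X V : Type u} [AddCommGroup A] [Module k A]
    [AddCommGroup B] [Module k B] [AddCommGroup X] [Module k X] [AddCommGroup V] [Module k V]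
    (φ : A →ₗ[k] Module.End k X) (ψ : B →ₗ[k] Module.End k V) (a : A) (b : B) (x : X) (v : V) :
    pairAct φ ψ (a ⊗ₜ b) (x ⊗ₜ v) = φ a x ⊗ₜ ψ b v := rfl

/-- If `φ` and `ψ` are actions of algebras, then so is `pairAct φ ψ`. -/
noncomputable def pairActAlg {A B X V : Type u} [Ring A] [Algebra k A] [Ring B] [Algebra k B]
    [AddCommGroup X] [Module k X] [AddCommGroup V] [Module k V]
    (φ : A →ₐ[k] Module.End k X) (ψ : B →ₐ[k] Module.End k V) :
    A ⊗[k] B →ₐ[k] Module.End k (X ⊗[k] V) :=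
  Algebra.TensorProduct.algHomOfLinearMapTensorProduct
    (pairAct φ.toLinearMap ψ.toLinearMap)
    (fun a₁ a₂ b₁ b₂ => by ext x v; simp)
    (by ext x v; simp)

@[simp] theorem pairActAlg_tmul {A B X V : Type u} [Ring A] [Algebra k A] [Ring B] [Algebra k B]
    [AddCommGroup X] [Module k X] [AddCommGroup V] [Module k V]
    (φ : A →ₐ[k] Module.End k X) (ψ : B →ₐ[k] Module.End k V) (a : A) (b : B) (x : X) (v : V) :
    pairActAlg φ ψ (a ⊗ₜ b) (x ⊗ₜ v) = φ a x ⊗ₜ ψ b v := rfl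

section

variable {H R X Y V : Type u} [Ring H] [Bialgebra k H] [Ring R] [Algebra k R]
  [AddCommGroup X] [Module k X] [AddCommGroup Y] [Module k Y] [AddCommGroup V] [Module k V]

theorem pairActAlg_lid (ψ : R →ₐ[k] Module.End k V) (z : H ⊗[k] R) (t : k ⊗[k] V) :
    TensorProduct.lid k V
        (pairActAlg ((Algebra.lmul k k).comp (Bialgebra.counitAlgHom k H)) ψ z t) =
      ψ (TensorProduct.lid k R ((Coalgebra.counit (R := k) (A := H)).rTensor R z))
        (TensorProduct.lid k V t) := by
  induction z with
  | zero => simp only [map_zero, LinearMap.zero_apply]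
  | add a b ha hb => simp only [map_add, LinearMap.add_apply, ha, hb]
  | tmul h r =>
    induction t with
    | zero => simp only [map_zero]
    | add a b ha hb => simp only [map_add, ha, hb]
    | tmul x v => simpa [mul_smul] using smul_comm _ _ _

theorem pairActAlg_rid (φ : H →ₐ[k] Module.End k X) (z : H ⊗[k] H) (t : X ⊗[k] k) :
    TensorProduct.rid k X
        (pairActAlg φ ((Algebra.lmul k k).comp (Bialgebra.counitAlgHom k H)) z t) =
      φ (TensorProduct.rid k H ((Coalgebra.counit (R := k) (A := H)).lTensor H z))
        (TensorProduct.rid k X t) := by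
  induction z with
  | zero => simp only [map_zero, LinearMap.zero_apply]
  | add a b ha hb => simp only [map_add, LinearMap.add_apply, ha, hb]
  | tmul h r =>
    induction t with
    | zero => simp only [map_zero]
    | add a b ha hb => simp only [map_add, ha, hb]
    | tmul x v => simpa [mul_smul] using smul_comm _ _ _

theorem pairActAlg_assoc (φ : H →ₐ[k] Module.End k X) (χ : H →ₐ[k] Module.End k Y)
    (ψ : R →ₐ[k] Module.End k V) (z : (H ⊗[k] H) ⊗[k] R) (t : (X ⊗[k] Y) ⊗[k] V) :
    TensorProduct.assoc k X Y V (pairActAlg (pairActAlg φ χ) ψ z t) =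
      pairActAlg φ (pairActAlg χ ψ) (TensorProduct.assoc k H H R z)
        (TensorProduct.assoc k X Y V t) := by
  have : (pairActAlg (pairActAlg φ χ) ψ).toLinearMap.compr₂
        (TensorProduct.assoc k X Y V).toLinearMap =
      ((pairActAlg φ (pairActAlg χ ψ)).toLinearMap ∘ₗ
        (TensorProduct.assoc k H H R).toLinearMap).compl₂
          (TensorProduct.assoc k X Y V).toLinearMap := by
    apply TensorProduct.ext_threefold
    intro a b r
    apply TensorProduct.ext_threefold
    intro x y v
    rfl
  exact LinearMap.congr_fun₂ this z t

theorem pairActAlg_comp_left {A B C : Type u} [Ring A] [Algebra k A] [Ring B] [Algebra k B]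
    [Ring C] [Algebra k C] (φ : B →ₐ[k] Module.End k X) (δ : A →ₐ[k] B)
    (ψ : C →ₐ[k] Module.End k V) (z : A ⊗[k] C) :
    pairActAlg (φ.comp δ) ψ z = pairActAlg φ ψ (δ.toLinearMap.rTensor C z) := by
  induction z with
  | zero => simp only [map_zero]
  | add a b ha hb => simp only [map_add, ha, hb]
  | tmul h r => rfl

theorem pairActAlg_comp_right {A B C : Type u} [Ring A] [Algebra k A] [Ring B] [Algebra k B]
    [Ring C] [Algebra k C] (ψ : C →ₐ[k] Module.End k X) (φ : B →ₐ[k] Module.End k V)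
    (δ : A →ₐ[k] B) (z : C ⊗[k] A) :
    pairActAlg ψ (φ.comp δ) z = pairActAlg ψ φ (δ.toLinearMap.lTensor C z) := by
  induction z with
  | zero => simp only [map_zero]
  | add a b ha hb => simp only [map_add, ha, hb]
  | tmul h r => rfl

end

end PairAct

/-! ## Comodule algebras -/

/-- A left `H`-comodule algebra `R`: a coassociative and counital left coaction
`R → H ⊗ R` that is a homomorphism of algebras. -/
class LeftComoduleAlgebra (k : Type u) [Field k] (H : Type u) [Ring H] [Bialgebra k H]
    (R : Type u) [Ring R] [Algebra k R] where
  coact : R →ₐ[k] H ⊗[k] R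
  coassoc : (TensorProduct.assoc k H H R).toLinearMap ∘ₗ
      (Coalgebra.comul (R := k) (A := H)).rTensor R ∘ₗ coact.toLinearMap =
    coact.toLinearMap.lTensor H ∘ₗ coact.toLinearMap
  counit_coact : (Coalgebra.counit (R := k) (A := H)).rTensor R ∘ₗ coact.toLinearMap =
    TensorProduct.mk k k R 1

namespace FDMod

section Action

variable {k : Type u} [Field k] {H : Type u} [Ring H] [Bialgebra k H]
  {R : Type u} [Ring R] [Algebra k R]

theorem map_pairActAlg {X X' : FDMod k H} {V V' : FDMod k R} (f : X ⟶ X') (g : V ⟶ V')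
    (z : H ⊗[k] R) (t : X.V ⊗[k] V.V) :
    TensorProduct.map f.lin g.lin (pairActAlg X.act V.act z t) =
      pairActAlg X'.act V'.act z (TensorProduct.map f.lin g.lin t) := by
  induction z with
  | zero => simp
  | add a b ha hb => simp [ha, hb]
  | tmul h r =>
    induction t with
    | zero => simp
    | add a b ha hb => simp [ha, hb]
    | tmul x v => simp [f.comm, g.comm]

/-- The bialgebra `H` as a left comodule algebra over itself (used only to write the
tensor product of two `H`-modules). -/
@[reducible] noncomputable def regularComoduleAlgebra (k : Type u) [Field k] (H : Type u)
    [Ring H] [Bialgebra k H] : LeftComoduleAlgebra k H H where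
  coact := Bialgebra.comulAlgHom k H
  coassoc := Coalgebra.coassoc
  counit_coact := Coalgebra.rTensor_counit_comp_comul

section

variable [LeftComoduleAlgebra k H R]

/-- The `R`-module `X ⊗ V` for an `H`-module `X` and an `R`-module `V`, with
`r (x ⊗ v) = r₍₋₁₎ x ⊗ r₍₀₎ v`. -/
noncomputable def tens (X : FDMod k H) (V : FDMod k R) : FDMod k R where
  V := X.V ⊗[k] V.V
  act := (pairActAlg X.act V.act).comp (LeftComoduleAlgebra.coact (k := k) (H := H) (R := R))

/-- The linear map `f ⊗ g` as a morphism of `R`-modules. -/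
noncomputable def tensHom {X X' : FDMod k H} {V V' : FDMod k R} (f : X ⟶ X') (g : V ⟶ V') :
    tens X V ⟶ tens X' V' :=
  ⟨TensorProduct.map f.lin g.lin, fun _ t => map_pairActAlg f g _ t⟩

@[simp] theorem tensHom_lin {X X' : FDMod k H} {V V' : FDMod k R} (f : X ⟶ X') (g : V ⟶ V') :
    (tensHom f g).lin = TensorProduct.map f.lin g.lin := rfl

/-- The trivial `H`-module `k`. -/
noncomputable def triv (k : Type u) [Field k] (H : Type u) [Ring H] [Bialgebra k H] :
    FDMod k H where
  V := k
  act := (Algebra.lmul k k).comp (Bialgebra.counitAlgHom k H)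

/-- The canonical isomorphism `k ⊗ V ≅ V`. -/
noncomputable def lunit (V : FDMod k R) : tens (triv k H) V ≅ V :=
  isoMk (X := tens (triv k H) V) (Y := V) (TensorProduct.lid k V.V)
    (fun r t => (pairActAlg_lid V.act (LeftComoduleAlgebra.coact (k := k) (H := H) r) t).trans (by
      have h := LinearMap.congr_fun
        (LeftComoduleAlgebra.counit_coact (k := k) (H := H) (R := R)) r
      simp only [LinearMap.comp_apply, AlgHom.toLinearMap_apply, TensorProduct.mk_apply] at h
      rw [h, TensorProduct.lid_tmul, one_smul]
      rfl))

@[simp] theorem lunit_hom_lin (V : FDMod k R) :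
    (lunit (H := H) V).hom.lin = (TensorProduct.lid k V.V).toLinearMap := rfl

@[simp] theorem lunit_inv_lin (V : FDMod k R) :
    (lunit (H := H) V).inv.lin = (TensorProduct.lid k V.V).symm.toLinearMap := rfl

end

section

variable [LeftComoduleAlgebra k H R]

/-- The tensor product of two `H`-modules, `h (x ⊗ y) = h₍₁₎ x ⊗ h₍₂₎ y`. -/
noncomputable abbrev tensH (X Y : FDMod k H) : FDMod k H :=
  letI := regularComoduleAlgebra k H
  tens X Y

/-- The canonical isomorphism `(X ⊗ Y) ⊗ V ≅ X ⊗ (Y ⊗ V)`. -/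
noncomputable def assocIso (X Y : FDMod k H) (V : FDMod k R) :
    tens (tensH X Y) V ≅ tens X (tens Y V) :=
  isoMk (X := tens (tensH X Y) V) (Y := tens X (tens Y V)) (TensorProduct.assoc k X.V Y.V V.V)
    (fun r t => by
      have h := LinearMap.congr_fun (LeftComoduleAlgebra.coassoc (k := k) (H := H) (R := R)) r
      simp only [LinearMap.comp_apply, AlgHom.toLinearMap_apply, LinearEquiv.coe_coe] at h
      have h₁ := pairActAlg_comp_left (pairActAlg X.act Y.act) (Bialgebra.comulAlgHom k H) V.act
        (LeftComoduleAlgebra.coact (k := k) (H := H) r)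
      have h₂ := pairActAlg_comp_right X.act (pairActAlg Y.act V.act)
        (LeftComoduleAlgebra.coact (k := k) (H := H))
        (LeftComoduleAlgebra.coact (k := k) (H := H) r)
      have h₃ := pairActAlg_assoc X.act Y.act V.act
        ((Coalgebra.comul (R := k) (A := H)).rTensor R
          (LeftComoduleAlgebra.coact (k := k) (H := H) r)) t
      rw [h, ← h₂] at h₃
      exact (congrArg (fun f => TensorProduct.assoc k X.V Y.V V.V (f t)) h₁).trans h₃)

@[simp] theorem assocIso_hom_lin (X Y : FDMod k H) (V : FDMod k R) :
    (assocIso X Y V).hom.lin = (TensorProduct.assoc k X.V Y.V V.V).toLinearMap := rfl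

@[simp] theorem assocIso_inv_lin (X Y : FDMod k H) (V : FDMod k R) :
    (assocIso X Y V).inv.lin = (TensorProduct.assoc k X.V Y.V V.V).symm.toLinearMap := rfl

end

/-- The canonical isomorphism `X ⊗ k ≅ X`. -/
noncomputable def runit (X : FDMod k H) : tensH X (triv k H) ≅ X :=
  isoMk (X := tensH X (triv k H)) (Y := X) (TensorProduct.rid k X.V)
    (fun r t => (pairActAlg_rid X.act (Coalgebra.comul r) t).trans (by
      have h := LinearMap.congr_fun (Coalgebra.lTensor_counit_comp_comul (R := k) (A := H)) r
      simp only [LinearMap.comp_apply, LinearMap.flip_apply, TensorProduct.mk_apply] at h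
      rw [h, TensorProduct.rid_tmul, one_smul]
      rfl))

@[simp] theorem runit_hom_lin (X : FDMod k H) :
    (runit X).hom.lin = (TensorProduct.rid k X.V).toLinearMap := rfl

@[simp] theorem runit_inv_lin (X : FDMod k H) :
    (runit X).inv.lin = (TensorProduct.rid k X.V).symm.toLinearMap := rfl

/-- The monoidal category `Rep H` of finite-dimensional `H`-modules. -/
noncomputable instance : MonoidalCategory (FDMod k H) :=
  letI := regularComoduleAlgebra k H
  { tensorObj := fun X Y => tens X Y
    whiskerLeft := fun X _ _ g => tensHom (𝟙 X) g
    whiskerRight := fun f Y => tensHom f (𝟙 Y)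
    tensorHom := fun f g => tensHom f g
    tensorUnit := triv k H
    associator := fun X Y Z => assocIso X Y Z
    leftUnitor := fun X => lunit X
    rightUnitor := fun X => runit X
    tensorHom_def := fun f g => by
      apply hom_ext; apply TensorProduct.ext'; intro x y; rfl
    id_tensorHom_id := fun X Y => by
      apply hom_ext; apply TensorProduct.ext'; intro x y; rfl
    tensorHom_comp_tensorHom := fun f g f' g' => by
      apply hom_ext; apply TensorProduct.ext'; intro x y; rfl
    whiskerLeft_id := fun X Y => by
      apply hom_ext; apply TensorProduct.ext'; intro x y; rfl
    id_whiskerRight := fun X Y => by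
      apply hom_ext; apply TensorProduct.ext'; intro x y; rfl
    associator_naturality := fun f g h => by
      apply hom_ext; apply TensorProduct.ext_threefold; intro x y z; rfl
    leftUnitor_naturality := fun f => by
      apply hom_ext; apply TensorProduct.ext'; intro c x
      exact (f.lin.map_smul (show k from c) x).symm
    rightUnitor_naturality := fun f => by
      apply hom_ext; apply TensorProduct.ext'; intro x c
      exact (f.lin.map_smul (show k from c) x).symm
    pentagon := fun W X Y Z => by
      apply hom_ext; apply TensorProduct.ext_fourfold; intro w x y z; rfl
    triangle := fun X Y => by
      apply hom_ext; apply TensorProduct.ext_threefold; intro x c y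
      exact (TensorProduct.smul_tmul (show k from c) x y).symm }

/-- For a left `H`-comodule algebra `R`, the category of finite-dimensional left `R`-modules is a
left module category over `Rep H`. -/
noncomputable instance [LeftComoduleAlgebra k H R] :
    MonoidalLeftAction (FDMod k H) (FDMod k R) where
  actionObj X V := tens X V
  actionHomLeft f V := tensHom f (𝟙 V)
  actionHomRight X _ _ g := tensHom (𝟙 X) g
  actionHom f g := tensHom f g
  actionAssocIso X Y V := assocIso X Y V
  actionUnitIso V := lunit V
  actionHom_def f g := by
    apply hom_ext; apply TensorProduct.ext'; intro x y; rfl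
  actionHomRight_id X V := by
    apply hom_ext; apply TensorProduct.ext'; intro x y; rfl
  id_actionHomLeft X V := by
    apply hom_ext; apply TensorProduct.ext'; intro x y; rfl
  actionHom_comp f f' g g' := by
    apply hom_ext; apply TensorProduct.ext'; intro x y; rfl
  actionAssocIso_hom_naturality f g h := by
    apply hom_ext; apply TensorProduct.ext_threefold; intro x y z; rfl
  actionUnitIso_hom_naturality f := by
    apply hom_ext; apply TensorProduct.ext'; intro c x
    exact f.lin.map_smul (show k from c) x
  whiskerLeft_actionHomLeft X _ _ f V := by
    apply hom_ext; apply TensorProduct.ext_threefold; intro x y z; rfl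
  whiskerRight_actionHomLeft Y f V := by
    apply hom_ext; apply TensorProduct.ext_threefold; intro x y z; rfl
  associator_actionHom X Y Z V := by
    apply hom_ext; apply TensorProduct.ext_fourfold; intro w x y z; rfl
  leftUnitor_actionHom X V := by
    apply hom_ext; apply TensorProduct.ext_threefold; intro c x y
    exact TensorProduct.smul_tmul' (show k from c) x y
  rightUnitor_actionHom X V := by
    apply hom_ext; apply TensorProduct.ext_threefold; intro x c y
    exact TensorProduct.smul_tmul (show k from c) x y

end Action

end FDMod

/-! ## Module functors -/

section ModuleFunctor

open Functor

/-- A module functor `(F, c) : D → D'` between `k`-linear module categories over `C`: a `k`-linear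
functor `F` with natural isomorphisms `c_{X,M} : F (X ⊗ M) → X ⊗ F M` (written `δₗ F X M` in
Mathlib) that are compatible with the associativity and unit constraints. -/
structure ModuleFunctor (k : Type*) [Field k] (C D D' : Type*) [Category* C] [Category* D]
    [Category* D'] [MonoidalCategory C] [Preadditive D] [Linear k D] [Preadditive D']
    [Linear k D'] [MonoidalLeftAction C D] [MonoidalLeftAction C D'] where
  F : D ⥤ D'
  [additive : F.Additive]
  [linear : F.Linear k]
  [oplax : F.OplaxLeftLinear C]
  isIso_c : ∀ (X : C) (M : D), IsIso (OplaxLeftLinear.δₗ F X M)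

namespace ModuleFunctor

attribute [instance] additive linear oplax isIso_c

variable {k : Type*} [Field k] {C D D' : Type*} [Category* C] [Category* D] [Category* D']
  [MonoidalCategory C] [Preadditive D] [Linear k D] [Preadditive D'] [Linear k D']
  [MonoidalLeftAction C D] [MonoidalLeftAction C D']

/-- The constraint `c_{X,M} : F (X ⊗ M) → X ⊗ F M`. -/
abbrev c (G : ModuleFunctor k C D D') (X : C) (M : D) :
    G.F.obj (X ⊙ₗ M) ⟶ X ⊙ₗ G.F.obj M :=
  OplaxLeftLinear.δₗ G.F X M

/-- A morphism of module functors: a natural transformation `α : F → G` with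
`d_{X,M} ∘ α_{X ⊗ M} = (id_X ⊗ α_M) ∘ c_{X,M}`. -/
@[ext]
structure Hom (F G : ModuleFunctor k C D D') where
  nat : F.F ⟶ G.F
  comm : ∀ (X : C) (M : D), nat.app (X ⊙ₗ M) ≫ G.c X M = F.c X M ≫ X ⊴ₗ nat.app M

instance : Category (ModuleFunctor k C D D') where
  Hom F G := Hom F G
  id F := ⟨𝟙 F.F, fun X M => by simp⟩
  comp α β := ⟨α.nat ≫ β.nat, fun X M => by
    rw [NatTrans.comp_app, NatTrans.comp_app, Category.assoc, β.comm, ← Category.assoc, α.comm,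
      Category.assoc, MonoidalLeftAction.actionHomRight_comp]⟩

/-- The functor that forgets the constraint. -/
@[simps]
def forget (k : Type*) [Field k] (C D D' : Type*) [Category* C] [Category* D]
    [Category* D'] [MonoidalCategory C] [Preadditive D] [Linear k D] [Preadditive D']
    [Linear k D'] [MonoidalLeftAction C D] [MonoidalLeftAction C D'] :
    ModuleFunctor k C D D' ⥤ (D ⥤ D') where
  obj F := F.F
  map α := α.nat

end ModuleFunctor

end ModuleFunctor

/-! ## Right exact functors and exact comodule algebras -/

namespace FDMod

variable {k : Type u} [Field k] {R S : Type u} [Ring R] [Algebra k R] [Ring S] [Algebra k S]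

/-- A functor between categories of finite-dimensional modules is right exact if it maps exact
sequences `X → Y → Z → 0` to exact sequences. -/
def IsRightExact (F : FDMod k R ⥤ FDMod k S) : Prop :=
  ∀ ⦃X Y Z : FDMod k R⦄ (f : X ⟶ Y) (g : Y ⟶ Z), Function.Exact f.lin g.lin →
    Function.Surjective g.lin →
      Function.Exact (F.map f).lin (F.map g).lin ∧ Function.Surjective (F.map g).lin

end FDMod

/-- The comodule algebra `R` is exact if the module category of finite-dimensional `R`-modules is
exact: `X ⊗ M` is projective for all projective `X` in `Rep H` and all `R`-modules `M`. (For a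
finite-dimensional `R` this category is always finite, so that this is not a separate
condition.) -/
def IsExactComoduleAlgebra (k : Type u) [Field k] (H : Type u) [Ring H] [Bialgebra k H]
    (R : Type u) [Ring R] [Algebra k R] [LeftComoduleAlgebra k H R] : Prop :=
  ∀ (X : FDMod k H) (M : FDMod k R), Projective X → Projective (X ⊙ₗ M : FDMod k R)

/-! ## Equivariant bimodules -/

/-- A finite-dimensional equivariant `(S, R)`-bimodule: an `(S, R)`-bimodule (with `k` acting
centrally) with a left `H`-comodule structure such that the coaction `P → H ⊗ P` is a morphism of
bimodules for `s (h ⊗ p) r = s₍₋₁₎ h r₍₋₁₎ ⊗ s₍₀₎ p r₍₀₎`. -/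
structure EquivariantBimod (k : Type u) [Field k] (H : Type u) [Ring H] [Bialgebra k H]
    (S R : Type u) [Ring S] [Algebra k S] [Ring R] [Algebra k R]
    [LeftComoduleAlgebra k H S] [LeftComoduleAlgebra k H R] where
  V : Type u
  [addCommGroup : AddCommGroup V]
  [module : Module k V]
  [finite : Module.Finite k V]
  /-- the left action of `S` -/
  left : S →ₐ[k] Module.End k V
  /-- the right action of `R`: `p r = right (op r) p` -/
  right : Rᵐᵒᵖ →ₐ[k] Module.End k V
  left_right : ∀ (s : S) (r : Rᵐᵒᵖ) (p : V), left s (right r p) = right r (left s p)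
  /-- the coaction of `H` -/
  coact : V →ₗ[k] H ⊗[k] V
  coassoc : (TensorProduct.assoc k H H V).toLinearMap ∘ₗ
      (Coalgebra.comul (R := k) (A := H)).rTensor V ∘ₗ coact = coact.lTensor H ∘ₗ coact
  counit_coact : (Coalgebra.counit (R := k) (A := H)).rTensor V ∘ₗ coact =
    TensorProduct.mk k k V 1
  coact_left : ∀ (s : S) (p : V), coact (left s p) =
    pairAct (LinearMap.mul k H) left.toLinearMap
      (LeftComoduleAlgebra.coact (k := k) (H := H) s) (coact p)
  coact_right : ∀ (r : R) (p : V), coact (right (MulOpposite.op r) p) =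
    pairAct (LinearMap.mul k H).flip
      (right.toLinearMap ∘ₗ (MulOpposite.opLinearEquiv k).toLinearMap)
      (LeftComoduleAlgebra.coact (k := k) (H := H) r) (coact p)

namespace EquivariantBimod

attribute [instance] EquivariantBimod.addCommGroup EquivariantBimod.module
  EquivariantBimod.finite

variable {k : Type u} [Field k] {H : Type u} [Ring H] [Bialgebra k H]
  {S R : Type u} [Ring S] [Algebra k S] [Ring R] [Algebra k R]
  [LeftComoduleAlgebra k H S] [LeftComoduleAlgebra k H R]

/-- Morphisms of equivariant bimodules: the maps of bimodules that are maps of comodules. -/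
@[ext]
structure Hom (P Q : EquivariantBimod k H S R) where
  lin : P.V →ₗ[k] Q.V
  comm_left : ∀ (s : S) (p : P.V), lin (P.left s p) = Q.left s (lin p)
  comm_right : ∀ (r : Rᵐᵒᵖ) (p : P.V), lin (P.right r p) = Q.right r (lin p)
  comm_coact : ∀ p : P.V, Q.coact (lin p) = lin.lTensor H (P.coact p)

instance : Category (EquivariantBimod k H S R) where
  Hom P Q := Hom P Q
  id P := ⟨LinearMap.id, fun _ _ => rfl, fun _ _ => rfl, fun p => by simp⟩
  comp f g := ⟨g.lin ∘ₗ f.lin, fun s p => by simp [f.comm_left, g.comm_left],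
    fun r p => by simp [f.comm_right, g.comm_right], fun p => by
      simp [f.comm_coact, g.comm_coact, LinearMap.lTensor_comp]⟩

@[simp] theorem id_lin (P : EquivariantBimod k H S R) : Hom.lin (𝟙 P) = LinearMap.id := rfl

@[simp] theorem comp_lin {P Q T : EquivariantBimod k H S R} (f : P ⟶ Q) (g : Q ⟶ T) :
    (f ≫ g).lin = g.lin ∘ₗ f.lin := rfl

/-- The subspace of `P ⊗ V` spanned by all `p r ⊗ v - p ⊗ r v`. -/
def balanced (P : EquivariantBimod k H S R) (V : FDMod k R) : Submodule k (P.V ⊗[k] V.V) :=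
  Submodule.span k {t | ∃ (p : P.V) (r : R) (v : V.V),
    t = P.right (MulOpposite.op r) p ⊗ₜ[k] v - p ⊗ₜ[k] V.act r v}

/-- The vector space `P ⊗_R V`. -/
abbrev BalTensor (P : EquivariantBimod k H S R) (V : FDMod k R) : Type u :=
  (P.V ⊗[k] V.V) ⧸ P.balanced V

/-- The bilinear map `(p, v) ↦ p ⊗_R v`. -/
def balMk (P : EquivariantBimod k H S R) (V : FDMod k R) :
    P.V →ₗ[k] V.V →ₗ[k] P.BalTensor V :=
  (TensorProduct.mk k P.V V.V).compr₂ (P.balanced V).mkQ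

theorem balMk_right (P : EquivariantBimod k H S R) (V : FDMod k R) (p : P.V) (r : R) (v : V.V) :
    P.balMk V (P.right (MulOpposite.op r) p) v = P.balMk V p (V.act r v) :=
  (Submodule.Quotient.eq _).2 (Submodule.subset_span ⟨p, r, v, rfl⟩)

theorem balTensor_ext {P : EquivariantBimod k H S R} {V : FDMod k R} {W : Type u}
    [AddCommGroup W] [Module k W] {f g : P.BalTensor V →ₗ[k] W}
    (h : ∀ p v, f (P.balMk V p v) = g (P.balMk V p v)) : f = g := by
  apply Submodule.linearMap_qext
  apply TensorProduct.ext'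
  exact h

/-- The map `P ⊗_R V → Q ⊗_R W` induced by a map `f : P → Q` of right `R`-modules and a map
`g : V → W` of left `R`-modules. -/
def balMap {P Q : EquivariantBimod k H S R} {V W : FDMod k R} (f : P.V →ₗ[k] Q.V)
    (hf : ∀ (r : Rᵐᵒᵖ) (p : P.V), f (P.right r p) = Q.right r (f p)) (g : V ⟶ W) :
    P.BalTensor V →ₗ[k] Q.BalTensor W :=
  Submodule.mapQ _ _ (TensorProduct.map f g.lin) (by
    rw [balanced, Submodule.span_le]
    rintro _ ⟨p, r, v, rfl⟩
    refine Submodule.subset_span ⟨f p, r, g.lin v, ?_⟩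
    simp [hf, g.comm])

@[simp] theorem balMap_balMk {P Q : EquivariantBimod k H S R} {V W : FDMod k R}
    (f : P.V →ₗ[k] Q.V) (hf) (g : V ⟶ W) (p : P.V) (v : V.V) :
    balMap f hf g (P.balMk V p v) = Q.balMk W (f p) (g.lin v) := rfl

/-- The left `S`-module `P ⊗_R V`, with `s (p ⊗_R v) = s p ⊗_R v`. -/
@[simps]
def tensorObj (P : EquivariantBimod k H S R) (V : FDMod k R) : FDMod k S where
  V := P.BalTensor V
  act := AlgHom.ofLinearMap
    { toFun := fun s => balMap (P.left s) (fun r p => P.left_right s r p) (𝟙 V)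
      map_add' := fun s s' => balTensor_ext fun p v => by simp
      map_smul' := fun a s => balTensor_ext fun p v => by simp }
    (balTensor_ext fun p v => by simp)
    (fun s s' => balTensor_ext fun p v => by simp)

/-- The functor that maps the bimodule `P` to the functor `P ⊗_R -` from left `R`-modules to left
`S`-modules, and a map `f` of bimodules to the natural transformation `f ⊗ id`. -/
def tensorFunctor (k : Type u) [Field k] (H : Type u) [Ring H] [Bialgebra k H]
    (S R : Type u) [Ring S] [Algebra k S] [Ring R] [Algebra k R]
    [LeftComoduleAlgebra k H S] [LeftComoduleAlgebra k H R] :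
    EquivariantBimod k H S R ⥤ (FDMod k R ⥤ FDMod k S) where
  obj P :=
    { obj := fun V => P.tensorObj V
      map := fun g => ⟨balMap LinearMap.id (fun _ _ => rfl) g, fun s t => by
        have : balMap (P := P) (Q := P) LinearMap.id (fun _ _ => rfl) g ∘ₗ
              (P.tensorObj _).act s =
            (P.tensorObj _).act s ∘ₗ balMap LinearMap.id (fun _ _ => rfl) g :=
          balTensor_ext fun p v => rfl
        exact LinearMap.congr_fun this t⟩
      map_id := fun V => FDMod.hom_ext (balTensor_ext fun p v => rfl)
      map_comp := fun f g => FDMod.hom_ext (balTensor_ext fun p v => rfl) }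
  map f :=
    { app := fun V => ⟨balMap f.lin f.comm_right (𝟙 V), fun s t => by
        have : balMap f.lin f.comm_right (𝟙 V) ∘ₗ (tensorObj _ V).act s =
            (tensorObj _ V).act s ∘ₗ balMap f.lin f.comm_right (𝟙 V) :=
          balTensor_ext fun p v => congrArg (fun q => balMk _ V q v) (f.comm_left s p)
        exact LinearMap.congr_fun this t⟩
      naturality := fun V W g => FDMod.hom_ext (balTensor_ext fun p v => rfl) }
  map_id P := by
    ext V : 2
    exact FDMod.hom_ext (balTensor_ext fun p v => rfl)
  map_comp f g := by
    ext V : 2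
    exact FDMod.hom_ext (balTensor_ext fun p v => rfl)

/-- For `p ∈ P`, `x ∈ X` and `v ∈ V`, the element `p₍₋₁₎ x ⊗ (p₍₀₎ ⊗_R v)` of
`X ⊗ (P ⊗_R V)`. -/
noncomputable def twist (P : EquivariantBimod k H S R) (X : FDMod k H) (V : FDMod k R)
    (p : P.V) (x : X.V) (v : V.V) : X.V ⊗[k] P.BalTensor V :=
  TensorProduct.map (X.act.toLinearMap.flip x) ((P.balMk V).flip v) (P.coact p)

end EquivariantBimod

/-!
The functor `P ↦ P ⊗_R -` is an equivalence by an argument of Eilenberg–Watts type in which the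
coaction of `P` and the module constraint of `P ⊗_R -` determine each other.

*The constraint is invertible.* The inverse of `p ⊗_R (x ⊗ v) ↦ p₍₋₁₎ x ⊗ (p₍₀₎ ⊗_R v)` is
`x ⊗ (p ⊗_R v) ↦ p₍₀₎ ⊗_R (T(p₍₋₁₎) x ⊗ v)`, where `T` is the inverse of the antipode `S`; see
`constraintLin_bijective`. So the antipode of a finite-dimensional Hopf algebra must be shown to
be bijective (`antipode_bijective`). Integrals are not needed for this. An algebra homomorphism `f`
on `H` is determined by `f ∘ S`, its convolution inverse, and hence, with a detour through the
opposite algebra, by `f ∘ S²`; that is, `S²` is an epimorphism of algebras. By Fitting's lemma the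
image of a high power of `S²` is a retract of `H` as an algebra, and the epimorphism property forces
the retraction to be the identity. So `S²`, and with it `S`, is injective.

*Fully faithful.* A natural transformation `P ⊗_R - → Q ⊗_R -` is given by its component at `R`
(`appLin_balMk`), a map `P → Q` of bimodules. Compatibility with the constraint at the modules `H`
and `R` says exactly that this map is colinear (`regComponent_coact`).

*Essentially surjective.* For a module functor `(F, c)` the bimodule is `F(R)`, with the right
action obtained by applying `F` to right multiplications, and with coaction `F(R) → F(H ⊗ R) →
H ⊗ F(R)`, the constraint after the image under `F` of the coaction of `R`, which is an
`R`-linear map `R → H ⊗ R`. All axioms and the compatibility of `F(R) ⊗_R - → F` with the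
constraints follow from naturality of `c` by way of one formula, `cLin_eval`. The map
`F(R) ⊗_R V → F(V)` is bijective for free modules `V` by additivity, and for all `V` when `F` is
right exact (`evalLin_bijective`).

*Exact `R`.* The `H`-module `H` is projective, and so all `R`-modules `H ⊗ M` are projective when
`R` is exact. Tensoring an exact sequence `X → Y → Z → 0` with `H` then makes it split; any additive
functor preserves the split sequence, the constraint moves the tensor factor `H` out of `F`, and
`H ⊗ -` reflects exactness. Thus every module functor is right exact
(`isRightExact_of_exact`).
-/

/-! ### The antipode of a finite-dimensional Hopf algebra is bijective -/

section Antipode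

open HopfAlgebra Coalgebra WithConv

variable {k : Type u} [Field k] {H : Type u} [Ring H] [HopfAlgebra k H]

theorem algHom_conv_comp_antipode {A : Type u} [Ring A] [Algebra k A] (F : H →ₐ[k] A) :
    toConv F.toLinearMap * toConv (F.toLinearMap ∘ₗ antipode k) = 1 := by
  ext c
  rw [(ℛ k c).convMul_apply]
  simpa [map_sum] using congrArg F (sum_mul_antipode_eq_algebraMap_counit (ℛ k c))

theorem algHom_comp_antipode_conv {A : Type u} [Ring A] [Algebra k A] (F : H →ₐ[k] A) :
    toConv (F.toLinearMap ∘ₗ antipode k) * toConv F.toLinearMap = 1 := by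
  ext c
  rw [(ℛ k c).convMul_apply]
  simpa [map_sum] using congrArg F (sum_antipode_mul_eq_algebraMap_counit (ℛ k c))

/-- Algebra homomorphisms out of a Hopf algebra are determined by their composites with the
antipode, because these composites are their convolution inverses. -/
theorem algHom_ext_of_comp_antipode {A : Type u} [Ring A] [Algebra k A] {F G : H →ₐ[k] A}
    (h : F.toLinearMap ∘ₗ antipode k = G.toLinearMap ∘ₗ antipode k) : F = G := by
  apply AlgHom.toLinearMap_injective
  apply WithConv.toConv_injective
  refine left_inv_eq_right_inv (algHom_conv_comp_antipode F) ?_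
  rw [h]
  exact algHom_comp_antipode_conv G

variable (k H) in
/-- The square of the antipode, as an endomorphism of algebras. -/
noncomputable def antipodeSq : H →ₐ[k] H :=
  AlgHom.ofLinearMap (antipode k ∘ₗ antipode k) (by simp)
    (fun x y => by simp [antipode_mul_antidistrib])

theorem antipodeSq_apply (h : H) : antipodeSq k H h = antipode k (antipode k h) := rfl

/-- The square of the antipode is an epimorphism of algebras: on passing to the opposite algebra,
`f ∘ S` and `g ∘ S` become algebra homomorphisms, so that
`algHom_ext_of_comp_antipode` applies twice. -/
theorem algHom_ext_of_comp_antipodeSq {A : Type u} [Ring A] [Algebra k A] {f g : H →ₐ[k] A}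
    (h : f.comp (antipodeSq k H) = g.comp (antipodeSq k H)) : f = g := by
  apply algHom_ext_of_comp_antipode
  have key : (AlgHom.op f).comp (antipodeAlgHomOp k H) =
      (AlgHom.op g).comp (antipodeAlgHomOp k H) := by
    apply algHom_ext_of_comp_antipode
    ext x
    exact congrArg MulOpposite.op (DFunLike.congr_fun h x)
  ext x
  exact congrArg MulOpposite.unop (DFunLike.congr_fun key x)

theorem algHom_ext_of_comp_antipodeSq_pow {A : Type u} [Ring A] [Algebra k A] (n : ℕ)
    {f g : H →ₐ[k] A} (h : f.comp (antipodeSq k H ^ n) = g.comp (antipodeSq k H ^ n)) :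
    f = g := by
  induction n with
  | zero => exact h
  | succ n ih =>
    refine ih (algHom_ext_of_comp_antipodeSq ?_)
    rw [pow_succ] at h
    exact h

/-- If the image of `ψ` meets the kernel of `ψ` trivially, then `ψ` restricts to an automorphism of
its image. The composite of `ψ` with the inverse of this automorphism is an algebra endomorphism
`e` that is the identity on the image of `ψ` and kills the kernel of `ψ`. -/
theorem exists_algHom_retraction {A : Type u} [Ring A] [Algebra k A] [Module.Finite k A]
    (ψ : A →ₐ[k] A) (hψ : Disjoint (LinearMap.ker ψ.toLinearMap) (LinearMap.range ψ.toLinearMap)) :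
    ∃ e : A →ₐ[k] A, e.comp ψ = ψ ∧ ∀ a, ψ a = 0 → e a = 0 := by
  let τ : ψ.range →ₐ[k] ψ.range := ψ.rangeRestrict.comp ψ.range.val
  have hinj : Function.Injective τ := by
    rw [injective_iff_map_eq_zero]
    rintro ⟨a, ha⟩ h
    have h0 : ψ a = 0 := congrArg Subtype.val h
    exact Subtype.ext ((Submodule.disjoint_def.1 hψ) a h0 (by
      obtain ⟨b, rfl⟩ := ha
      exact ⟨b, rfl⟩))
  have hfin : Module.Finite k ψ.range :=
    inferInstanceAs (Module.Finite k (Subalgebra.toSubmodule ψ.range))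
  have hbij : Function.Bijective τ :=
    ⟨hinj, LinearMap.injective_iff_surjective (f := τ.toLinearMap).1 hinj⟩
  let τ' := AlgEquiv.ofBijective τ hbij
  refine ⟨(ψ.range.val.comp τ'.symm.toAlgHom).comp ψ.rangeRestrict, ?_, ?_⟩
  · ext a
    have : τ'.symm (ψ.rangeRestrict (ψ a)) = ψ.rangeRestrict a := by
      rw [AlgEquiv.symm_apply_eq]
      rfl
    exact congrArg Subtype.val this
  · intro a ha
    have h0 : ψ.rangeRestrict a = 0 := Subtype.ext ha
    simp [h0]

/-- By Fitting's lemma a power of `S²` has a retract of `H` as its image; as `S²` is an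
epimorphism, the retraction is the identity, and so `S²` is injective. -/
theorem antipode_bijective [Module.Finite k H] :
    Function.Bijective (antipode k : H →ₗ[k] H) := by
  obtain ⟨n, hn, hn1⟩ := ((Module.End.eventually_disjoint_ker_pow_range_pow
    (antipodeSq k H).toLinearMap).and (Filter.eventually_ge_atTop 1)).exists
  have hpow : ∀ m : ℕ, (antipodeSq k H ^ m).toLinearMap = (antipodeSq k H).toLinearMap ^ m := by
    intro m
    induction m with
    | zero => rfl
    | succ m ih => rw [pow_succ, pow_succ, ← ih]; rfl
  rw [← hpow] at hn
  obtain ⟨e, he, he0⟩ := exists_algHom_retraction _ hn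
  have hid : e = AlgHom.id k H := algHom_ext_of_comp_antipodeSq_pow n he
  have hinj : Function.Injective (antipode k : H →ₗ[k] H) := by
    rw [injective_iff_map_eq_zero]
    intro a ha
    have h1 : (antipodeSq k H ^ n) a = 0 := by
      obtain ⟨m, rfl⟩ := Nat.exists_eq_add_of_le' hn1
      rw [pow_succ]
      show (antipodeSq k H ^ m) (antipodeSq k H a) = 0
      rw [antipodeSq_apply, ha, map_zero, map_zero]
    have := he0 a h1
    rwa [hid] at this
  exact ⟨hinj, LinearMap.injective_iff_surjective.1 hinj⟩

/-- The inverse `T` of the antipode is an antipode for the opposite comultiplication: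
`T(h₍₂₎) h₍₁₎ = ε(h) = h₍₂₎ T(h₍₁₎)`. -/
theorem exists_skew_antipode [Module.Finite k H] : ∃ T : H →ₗ[k] H,
    (∀ h, LinearMap.mul' k H (TensorProduct.comm k H H (T.lTensor H (comul (R := k) h))) =
      algebraMap k H (counit h)) ∧
    (∀ h, LinearMap.mul' k H (TensorProduct.comm k H H (T.rTensor H (comul (R := k) h))) =
      algebraMap k H (counit h)) ∧
    (∀ g h, T (g * h) = T h * T g) := by
  let e : H ≃ₗ[k] H := LinearEquiv.ofBijective (antipode k) antipode_bijective
  have he : ∀ h, antipode k (e.symm h) = h := fun h => e.apply_symm_apply h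
  have hinj := (antipode_bijective (k := k) (H := H)).1
  refine ⟨e.symm.toLinearMap, fun h => hinj ?_, fun h => hinj ?_, fun g h => hinj ?_⟩
  · have h1 : ∀ z : H ⊗[k] H, antipode k (LinearMap.mul' k H (TensorProduct.comm k H H
        (e.symm.toLinearMap.lTensor H z))) =
        LinearMap.mul' k H ((antipode k).rTensor H z) := by
      intro z
      induction z with
      | zero => simp
      | add a b ha hb => simp only [map_add, ha, hb]
      | tmul a b => simp [antipode_mul_antidistrib, he]
    rw [h1, mul_antipode_rTensor_comul_apply, Algebra.algebraMap_eq_smul_one, map_smul,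
      antipode_one]
  · have h1 : ∀ z : H ⊗[k] H, antipode k (LinearMap.mul' k H (TensorProduct.comm k H H
        (e.symm.toLinearMap.rTensor H z))) =
        LinearMap.mul' k H ((antipode k).lTensor H z) := by
      intro z
      induction z with
      | zero => simp
      | add a b ha hb => simp only [map_add, ha, hb]
      | tmul a b => simp [antipode_mul_antidistrib, he]
    rw [h1, mul_antipode_lTensor_comul_apply, Algebra.algebraMap_eq_smul_one, map_smul,
      antipode_one]
  · simp [antipode_mul_antidistrib, he]

end Antipode

/-! ### Maps that combine a coaction with an action -/

section CrossMap

variable {k : Type u} [Field k] {A B P Q V V' W W' U X X' Y : Type u}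
  [AddCommGroup A] [Module k A] [AddCommGroup B] [Module k B]
  [AddCommGroup P] [Module k P] [AddCommGroup Q] [Module k Q]
  [AddCommGroup V] [Module k V] [AddCommGroup V'] [Module k V']
  [AddCommGroup W] [Module k W] [AddCommGroup W'] [Module k W'] [AddCommGroup U] [Module k U]
  [AddCommGroup X] [Module k X] [AddCommGroup X'] [Module k X'] [AddCommGroup Y] [Module k Y]

/-- For `φ : A → End X` and a bilinear map `b : P × V → W`, the map that sends `a ⊗ p` to
`x ⊗ v ↦ φ a x ⊗ b p v`. -/
noncomputable def crossMap (φ : A →ₗ[k] Module.End k X) (b : P →ₗ[k] V →ₗ[k] W) :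
    A ⊗[k] P →ₗ[k] X ⊗[k] V →ₗ[k] X ⊗[k] W :=
  TensorProduct.homTensorHomMap (RingHom.id k) X V X W ∘ₗ TensorProduct.map φ b

@[simp] theorem crossMap_tmul (φ : A →ₗ[k] Module.End k X) (b : P →ₗ[k] V →ₗ[k] W) (a : A)
    (p : P) (x : X) (v : V) : crossMap φ b (a ⊗ₜ p) (x ⊗ₜ v) = φ a x ⊗ₜ b p v := rfl

theorem crossMap_flip_tmul (φ : A →ₗ[k] Module.End k X) (b : P →ₗ[k] V →ₗ[k] W) (x : X) (v : V)
    (w : A ⊗[k] P) : crossMap φ b w (x ⊗ₜ v) = TensorProduct.map (φ.flip x) (b.flip v) w := by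
  induction w with
  | zero => simp
  | add a b ha hb => simp only [map_add, LinearMap.add_apply, ha, hb]
  | tmul h q => simp

theorem crossMap_eq_pairAct (φ : A →ₗ[k] Module.End k X) (ψ : P →ₗ[k] Module.End k V) :
    crossMap φ ψ = pairAct φ ψ := by
  ext a p x v
  rfl

/-- For `φ : A → End X` and a bilinear map `b : P × (X ⊗ V) → W`, the map that sends `a ⊗ p` to
`x ⊗ v ↦ b p (φ a x ⊗ v)`. -/
noncomputable def insertMap (φ : A →ₗ[k] Module.End k X) (b : P →ₗ[k] X ⊗[k] V →ₗ[k] W) :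
    A ⊗[k] P →ₗ[k] X ⊗[k] V →ₗ[k] W :=
  TensorProduct.lift (LinearMap.mk₂ k (fun a p => b p ∘ₗ (φ a).rTensor V)
    (fun a a' p => by simp [LinearMap.rTensor_add, LinearMap.comp_add])
    (fun c a p => by simp [LinearMap.rTensor_smul, LinearMap.comp_smul])
    (fun a p p' => by simp [LinearMap.add_comp])
    (fun c a p => by simp [LinearMap.smul_comp]))

@[simp] theorem insertMap_tmul (φ : A →ₗ[k] Module.End k X) (b : P →ₗ[k] X ⊗[k] V →ₗ[k] W)
    (a : A) (p : P) (x : X) (v : V) : insertMap φ b (a ⊗ₜ p) (x ⊗ₜ v) = b p (φ a x ⊗ₜ v) := rfl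

theorem crossMap_map (φ : A →ₗ[k] Module.End k X) (φ' : A →ₗ[k] Module.End k X')
    (b : P →ₗ[k] V →ₗ[k] W) (b' : Q →ₗ[k] V' →ₗ[k] W') (f : X →ₗ[k] X') (g : V →ₗ[k] V')
    (m : W →ₗ[k] W') (q : P →ₗ[k] Q) (hf : ∀ a x, f (φ a x) = φ' a (f x))
    (hb : ∀ p v, b' (q p) (g v) = m (b p v)) (w : A ⊗[k] P) (t : X ⊗[k] V) :
    crossMap φ' b' (q.lTensor A w) (TensorProduct.map f g t) =
      TensorProduct.map f m (crossMap φ b w t) := by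
  induction w with
  | zero => simp
  | add a b ha hb => simp only [map_add, LinearMap.add_apply, ha, hb]
  | tmul h p =>
    induction t with
    | zero => simp
    | add a b ha hb => simp only [map_add, ha, hb]
    | tmul x v => simp [hf, hb]

theorem crossMap_lTensor (φ : A →ₗ[k] Module.End k X) (b : P →ₗ[k] V →ₗ[k] W)
    (b' : Q →ₗ[k] V →ₗ[k] W') (m : W →ₗ[k] W') (q : P →ₗ[k] Q)
    (hb : ∀ p v, b' (q p) v = m (b p v)) (w : A ⊗[k] P) (t : X ⊗[k] V) :
    crossMap φ b' (q.lTensor A w) t = m.lTensor X (crossMap φ b w t) := by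
  have h := crossMap_map φ φ b b' LinearMap.id LinearMap.id m q (fun _ _ => rfl) hb w t
  rwa [TensorProduct.map_id] at h

theorem crossMap_crossMap_assoc (φ : A →ₗ[k] Module.End k X) (χ : A →ₗ[k] Module.End k Y)
    (b : P →ₗ[k] V →ₗ[k] W) (δ : B →ₗ[k] A ⊗[k] A) (w : B ⊗[k] P) (t : (X ⊗[k] Y) ⊗[k] V) :
    TensorProduct.assoc k X Y W (crossMap (pairAct φ χ ∘ₗ δ) b w t) =
      crossMap φ (crossMap χ b) (TensorProduct.assoc k A A P (δ.rTensor P w))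
        (TensorProduct.assoc k X Y V t) := by
  induction w with
  | zero => simp
  | add a b ha hb => simp only [map_add, LinearMap.add_apply, ha, hb]
  | tmul h p =>
    induction t with
    | zero => simp
    | add a b ha hb => simp only [map_add, ha, hb]
    | tmul s v =>
      simp only [crossMap_tmul, LinearMap.comp_apply, LinearMap.rTensor_tmul]
      generalize δ h = d
      induction d with
      | zero => simp
      | add a b ha hb =>
        simp only [map_add, LinearMap.add_apply, TensorProduct.add_tmul, ha, hb]
      | tmul a a' =>
        induction s with
        | zero => simp
        | add a b ha hb => simp only [map_add, TensorProduct.add_tmul, ha, hb]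
        | tmul x y => simp

theorem crossMap_scalar (ε : A →ₗ[k] k) (b : P →ₗ[k] V →ₗ[k] W) (w : A ⊗[k] P) (v : V) :
    crossMap ((Algebra.lmul k k).toLinearMap ∘ₗ ε) b w ((1 : k) ⊗ₜ v) =
      (b.flip v).lTensor k (ε.rTensor P w) := by
  induction w with
  | zero => simp
  | add a b ha hb => simp only [map_add, LinearMap.add_apply, ha, hb]
  | tmul h p => simp

theorem insertMap_lTensor (φ : A →ₗ[k] Module.End k X) (b : P →ₗ[k] X ⊗[k] V →ₗ[k] W)
    (q : Q →ₗ[k] P) (w : A ⊗[k] Q) :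
    insertMap φ b (q.lTensor A w) = insertMap φ (b ∘ₗ q) w := by
  induction w with
  | zero => simp
  | add a b ha hb => simp only [map_add, ha, hb]
  | tmul h p => rfl

theorem apply_insertMap (φ : A →ₗ[k] Module.End k X) (b : P →ₗ[k] X ⊗[k] V →ₗ[k] W)
    (m : W →ₗ[k] U) (w : A ⊗[k] P) (t : X ⊗[k] V) :
    m (insertMap φ b w t) = insertMap φ (b.compr₂ m) w t := by
  induction w with
  | zero => simp
  | add a b ha hb => simp only [map_add, LinearMap.add_apply, ha, hb]
  | tmul h p => rfl

/-- If `D` maps `x ⊗ b p v` to `e p (x ⊗ v)`, then it turns `crossMap φ b` into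
`insertMap φ e`. -/
theorem apply_crossMap (φ : A →ₗ[k] Module.End k X) (b : P →ₗ[k] V →ₗ[k] W)
    (e : P →ₗ[k] X ⊗[k] V →ₗ[k] U) (D : X ⊗[k] W →ₗ[k] U)
    (hD : ∀ x p v, D (x ⊗ₜ b p v) = e p (x ⊗ₜ v)) (w : A ⊗[k] P) (t : X ⊗[k] V) :
    D (crossMap φ b w t) = insertMap φ e w t := by
  induction w with
  | zero => simp
  | add a b ha hb => simp only [map_add, LinearMap.add_apply, ha, hb]
  | tmul h p =>
    induction t with
    | zero => simp
    | add a b ha hb => simp only [map_add, ha, hb]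
    | tmul x v => simp [hD]

section Hopf

variable {H R S : Type u} [Ring H] [Bialgebra k H] [AddCommGroup R] [Module k R]
  [AddCommGroup S] [Module k S]

theorem crossMap_pairAct_right (φ : H →ₐ[k] Module.End k X) (b : P →ₗ[k] V →ₗ[k] W)
    (ρ : R →ₗ[k] Module.End k P) (ψ : R →ₗ[k] Module.End k V)
    (hb : ∀ p r v, b (ρ r p) v = b p (ψ r v)) (z : H ⊗[k] R) (w : H ⊗[k] P) (t : X ⊗[k] V) :
    crossMap φ.toLinearMap b (pairAct (LinearMap.mul k H).flip ρ z w) t =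
      crossMap φ.toLinearMap b w (pairAct φ.toLinearMap ψ z t) := by
  induction z with
  | zero => simp
  | add a b ha hb => simp only [map_add, LinearMap.add_apply, ha, hb]
  | tmul h r =>
    induction w with
    | zero => simp
    | add a b ha hb => simp only [map_add, LinearMap.add_apply, ha, hb]
    | tmul g q =>
      induction t with
      | zero => simp
      | add a b ha hb => simp only [map_add, ha, hb]
      | tmul x v => simp [hb]

theorem crossMap_pairAct_left (φ : H →ₐ[k] Module.End k X) (b : P →ₗ[k] V →ₗ[k] W)
    (l : S →ₗ[k] Module.End k P) (ψ : S →ₗ[k] Module.End k W)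
    (hb : ∀ s p v, b (l s p) v = ψ s (b p v)) (z : H ⊗[k] S) (w : H ⊗[k] P) (t : X ⊗[k] V) :
    crossMap φ.toLinearMap b (pairAct (LinearMap.mul k H) l z w) t =
      pairAct φ.toLinearMap ψ z (crossMap φ.toLinearMap b w t) := by
  induction z with
  | zero => simp
  | add a b ha hb => simp only [map_add, LinearMap.add_apply, ha, hb]
  | tmul h r =>
    induction w with
    | zero => simp
    | add a b ha hb => simp only [map_add, LinearMap.add_apply, ha, hb]
    | tmul g q =>
      induction t with
      | zero => simp
      | add a b ha hb => simp only [map_add, ha, hb]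
      | tmul x v => simp [hb]

theorem crossMap_lmul (b : P →ₗ[k] V →ₗ[k] P) (z : H ⊗[k] V) (w : H ⊗[k] P) :
    crossMap (Algebra.lmul k H).toLinearMap b w z =
      pairAct (LinearMap.mul k H).flip b.flip z w := by
  induction z with
  | zero => simp
  | add a b ha hb => simp only [map_add, LinearMap.add_apply, ha, hb]
  | tmul h r =>
    induction w with
    | zero => simp
    | add a b ha hb => simp only [map_add, LinearMap.add_apply, ha, hb]
    | tmul g q => simp

theorem crossMap_lmul_one (b : P →ₗ[k] V →ₗ[k] W) (v : V) (w : H ⊗[k] P) :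
    crossMap (Algebra.lmul k H).toLinearMap b w ((1 : H) ⊗ₜ v) = (b.flip v).lTensor H w := by
  induction w with
  | zero => simp
  | add a b ha hb => simp only [map_add, LinearMap.add_apply, ha, hb]
  | tmul g q => simp

theorem pairAct_lmul_one_tmul_one {A B : Type u} [Ring A] [Algebra k A] [Ring B] [Algebra k B]
    (z : A ⊗[k] B) : pairAct (Algebra.lmul k A).toLinearMap (Algebra.lmul k B).toLinearMap z
      ((1 : A) ⊗ₜ (1 : B)) = z := by
  induction z with
  | zero => simp
  | add a b ha hb => simp only [map_add, LinearMap.add_apply, ha, hb]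
  | tmul h r => simp

variable {T : H →ₗ[k] H}

/-- The effect of `h₍₂₎ T(h₍₁₎) = ε(h)`. -/
theorem insertMap_crossMap_comul (φ : H →ₐ[k] Module.End k X) (b : P →ₗ[k] V →ₗ[k] W)
    (hT : ∀ h, LinearMap.mul' k H (TensorProduct.comm k H H (T.rTensor H
      (Coalgebra.comul (R := k) h))) = algebraMap k H (Coalgebra.counit h))
    (w : H ⊗[k] P) (t : X ⊗[k] V) :
    insertMap (φ.toLinearMap ∘ₗ T) (crossMap φ.toLinearMap b)
        (TensorProduct.assoc k H H P ((Coalgebra.comul (R := k) (A := H)).rTensor P w)) t =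
      (b (TensorProduct.lid k P ((Coalgebra.counit (R := k) (A := H)).rTensor P w))).lTensor X
        t := by
  induction w with
  | zero => simp
  | add a b ha hb => simp only [map_add, LinearMap.add_apply, LinearMap.lTensor_add, ha, hb]
  | tmul h q =>
    induction t with
    | zero => simp
    | add a b ha hb => simp only [map_add, ha, hb]
    | tmul x v =>
      have key : ∀ d : H ⊗[k] H, insertMap (φ.toLinearMap ∘ₗ T) (crossMap φ.toLinearMap b)
          (TensorProduct.assoc k H H P (d ⊗ₜ q)) (x ⊗ₜ v) =
          φ (LinearMap.mul' k H (TensorProduct.comm k H H (T.rTensor H d))) x ⊗ₜ b q v := by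
        intro d
        induction d with
        | zero => simp
        | add a b ha hb =>
          simp only [map_add, LinearMap.add_apply, TensorProduct.add_tmul, ha, hb]
        | tmul a a' => simp
      rw [LinearMap.rTensor_tmul, key, hT]
      simp [TensorProduct.smul_tmul]

/-- The effect of `T(h₍₂₎) h₍₁₎ = ε(h)`. -/
theorem insertMap_insertMap_comul (φ : H →ₐ[k] Module.End k X) (b : P →ₗ[k] X ⊗[k] V →ₗ[k] W)
    (hT : ∀ h, LinearMap.mul' k H (TensorProduct.comm k H H (T.lTensor H
      (Coalgebra.comul (R := k) h))) = algebraMap k H (Coalgebra.counit h))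
    (w : H ⊗[k] P) (t : X ⊗[k] V) :
    insertMap φ.toLinearMap (insertMap (φ.toLinearMap ∘ₗ T) b)
        (TensorProduct.assoc k H H P ((Coalgebra.comul (R := k) (A := H)).rTensor P w)) t =
      b (TensorProduct.lid k P ((Coalgebra.counit (R := k) (A := H)).rTensor P w)) t := by
  induction w with
  | zero => simp
  | add a b ha hb => simp only [map_add, LinearMap.add_apply, ha, hb]
  | tmul h q =>
    induction t with
    | zero => simp
    | add a b ha hb => simp only [map_add, ha, hb]
    | tmul x v =>
      have key : ∀ d : H ⊗[k] H, insertMap φ.toLinearMap (insertMap (φ.toLinearMap ∘ₗ T) b)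
          (TensorProduct.assoc k H H P (d ⊗ₜ q)) (x ⊗ₜ v) =
          b q (φ (LinearMap.mul' k H (TensorProduct.comm k H H (T.lTensor H d))) x ⊗ₜ v) := by
        intro d
        induction d with
        | zero => simp
        | add a b ha hb =>
          simp only [map_add, LinearMap.add_apply, TensorProduct.add_tmul, ha, hb]
        | tmul a a' => simp
      rw [LinearMap.rTensor_tmul, key, hT]
      simp [← TensorProduct.smul_tmul']

/-- If `b` is balanced, then so is `insertMap (φ ∘ T) b` for elements `z` of `H ⊗ R` on which
`r₍₀₎ (T(r₍₋₁₎) x ⊗ v) = x ⊗ r v` holds. -/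
theorem insertMap_pairAct_right (φ : H →ₐ[k] Module.End k X) (b : P →ₗ[k] X ⊗[k] V →ₗ[k] W)
    (ρ : R →ₗ[k] Module.End k P) (ψ : R →ₗ[k] Module.End k (X ⊗[k] V))
    (hb : ∀ p r v, b (ρ r p) v = b p (ψ r v)) (hT : ∀ g h, T (g * h) = T h * T g)
    (z : H ⊗[k] R) (w : H ⊗[k] P) (ψ' : Module.End k V)
    (hz : ∀ t, insertMap (φ.toLinearMap ∘ₗ T) ψ z t = ψ'.lTensor X t) (t : X ⊗[k] V) :
    insertMap (φ.toLinearMap ∘ₗ T) b (pairAct (LinearMap.mul k H).flip ρ z w) t =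
      insertMap (φ.toLinearMap ∘ₗ T) b w (ψ'.lTensor X t) := by
  induction w with
  | zero => simp
  | add a b ha hb => simp only [map_add, LinearMap.add_apply, ha, hb]
  | tmul g q =>
    induction t with
    | zero => simp
    | add a b ha hb => simp only [map_add, ha, hb]
    | tmul x v =>
      have key : insertMap (φ.toLinearMap ∘ₗ T) b
          (pairAct (LinearMap.mul k H).flip ρ z (g ⊗ₜ q)) (x ⊗ₜ v) =
          b q (insertMap (φ.toLinearMap ∘ₗ T) ψ z (φ (T g) x ⊗ₜ v)) := by
        clear hz
        induction z with
        | zero => simp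
        | add a b ha hb => simp only [map_add, LinearMap.add_apply, ha, hb]
        | tmul h r => simp [hb, hT]
      rw [key, hz]
      simp

end Hopf

end CrossMap

/-! ### The module functor `P ⊗_R -` -/

namespace EquivariantBimod

section

variable {k : Type u} [Field k] {H : Type u} [Ring H] [Bialgebra k H]
  {S R : Type u} [Ring S] [Algebra k S] [Ring R] [Algebra k R]
  [LeftComoduleAlgebra k H S] [LeftComoduleAlgebra k H R]

/-- A balanced bilinear map on `P × V` descends to `P ⊗_R V`. -/
def balLift {P : EquivariantBimod k H S R} {V : FDMod k R} {W : Type u}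
    [AddCommGroup W] [Module k W] (b : P.V →ₗ[k] V.V →ₗ[k] W)
    (hb : ∀ p r v, b (P.right (MulOpposite.op r) p) v = b p (V.act r v)) :
    P.BalTensor V →ₗ[k] W :=
  (P.balanced V).liftQ (TensorProduct.lift b) (by
    rw [balanced, Submodule.span_le]
    rintro _ ⟨p, r, v, rfl⟩
    simp [hb])

@[simp] theorem balLift_balMk {P : EquivariantBimod k H S R} {V : FDMod k R} {W : Type u}
    [AddCommGroup W] [Module k W] (b : P.V →ₗ[k] V.V →ₗ[k] W) (hb) (p : P.V) (v : V.V) :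
    balLift b hb (P.balMk V p v) = b p v := rfl

theorem exists_lift_tmul_balMk {P : EquivariantBimod k H S R} {V : FDMod k R} {X W : Type u}
    [AddCommGroup X] [Module k X] [AddCommGroup W] [Module k W]
    (b : P.V →ₗ[k] X ⊗[k] V.V →ₗ[k] W)
    (hb : ∀ p r t, b (P.right (MulOpposite.op r) p) t = b p ((V.act r).lTensor X t)) :
    ∃ D : X ⊗[k] P.BalTensor V →ₗ[k] W, ∀ x p v, D (x ⊗ₜ P.balMk V p v) = b p (x ⊗ₜ v) :=
  ⟨TensorProduct.lift
    { toFun := fun x => balLift (b.compl₂ (TensorProduct.mk k X V.V x))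
        (fun p r v => hb p r (x ⊗ₜ v))
      map_add' := fun x y => balTensor_ext fun p v => by
        simp
        rfl
      map_smul' := fun c x => balTensor_ext fun p v => by
        simp
        rfl },
    fun _ _ _ => rfl⟩

theorem twist_eq (P : EquivariantBimod k H S R) (X : FDMod k H) (V : FDMod k R)
    (p : P.V) (x : X.V) (v : V.V) :
    P.twist X V p x v = crossMap X.act.toLinearMap (P.balMk V) (P.coact p) (x ⊗ₜ v) := by
  rw [twist, crossMap_flip_tmul]

theorem coassoc_apply (P : EquivariantBimod k H S R) (p : P.V) :
    TensorProduct.assoc k H H P.V ((Coalgebra.comul (R := k) (A := H)).rTensor P.V (P.coact p)) =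
      P.coact.lTensor H (P.coact p) :=
  LinearMap.congr_fun P.coassoc p

theorem counit_coact_apply (P : EquivariantBimod k H S R) (p : P.V) :
    (Coalgebra.counit (R := k) (A := H)).rTensor P.V (P.coact p) = (1 : k) ⊗ₜ p :=
  LinearMap.congr_fun P.counit_coact p

theorem crossMap_coact_right (P : EquivariantBimod k H S R) (X : FDMod k H) (V : FDMod k R)
    (p : P.V) (r : R) (t : X.V ⊗[k] V.V) :
    crossMap X.act.toLinearMap (P.balMk V) (P.coact (P.right (MulOpposite.op r) p)) t =
      crossMap X.act.toLinearMap (P.balMk V) (P.coact p)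
        (pairAct X.act.toLinearMap V.act.toLinearMap
      (LeftComoduleAlgebra.coact (k := k) (H := H) r) t) := by
  rw [P.coact_right]
  apply crossMap_pairAct_right
  exact fun p r v => balMk_right P V p r v

/-- The map `p ⊗_R (x ⊗ v) ↦ p₍₋₁₎ x ⊗ (p₍₀₎ ⊗_R v)`. -/
noncomputable def constraintLin (P : EquivariantBimod k H S R) (X : FDMod k H) (V : FDMod k R) :
    P.BalTensor (X ⊙ₗ V) →ₗ[k] X.V ⊗[k] P.BalTensor V :=
  balLift (V := X ⊙ₗ V) (crossMap X.act.toLinearMap (P.balMk V) ∘ₗ P.coact)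
    (P.crossMap_coact_right X V)

/-- The constraint `P ⊗_R (X ⊗ V) → X ⊗ (P ⊗_R V)` as a morphism of `S`-modules. -/
noncomputable def constraint (P : EquivariantBimod k H S R) (X : FDMod k H) (V : FDMod k R) :
    P.tensorObj (X ⊙ₗ V) ⟶ X ⊙ₗ P.tensorObj V :=
  ⟨P.constraintLin X V, fun s => LinearMap.congr_fun
    (f := P.constraintLin X V ∘ₗ (P.tensorObj (X ⊙ₗ V)).act s)
    (g := ((X ⊙ₗ P.tensorObj V).act s : _ →ₗ[k] _) ∘ₗ P.constraintLin X V)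
    (balTensor_ext (V := X ⊙ₗ V) fun p t => by
      show crossMap X.act.toLinearMap (P.balMk V) (P.coact (P.left s p)) t = _
      rw [P.coact_left]
      exact crossMap_pairAct_left X.act (P.balMk V) _ (P.tensorObj V).act.toLinearMap
        (fun s p v => rfl) _ _ t)⟩

/-- The map `(p, x ⊗ v) ↦ p ⊗_R (x ⊗ v)`. -/
noncomputable def balMkTens (P : EquivariantBimod k H S R) (X : FDMod k H) (V : FDMod k R) :
    P.V →ₗ[k] X.V ⊗[k] V.V →ₗ[k] P.BalTensor (X ⊙ₗ V) :=
  P.balMk (X ⊙ₗ V)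

theorem balMkTens_right (P : EquivariantBimod k H S R) (X : FDMod k H) (V : FDMod k R) (p : P.V)
    (r : R) (t : X.V ⊗[k] V.V) : P.balMkTens X V (P.right (MulOpposite.op r) p) t =
      P.balMkTens X V p (pairAct X.act.toLinearMap V.act.toLinearMap
        (LeftComoduleAlgebra.coact (k := k) (H := H) r) t) :=
  P.balMk_right (X ⊙ₗ V) p r t

theorem constraintLin_balMkTens (P : EquivariantBimod k H S R) (X : FDMod k H) (V : FDMod k R)
    (p : P.V) (t : X.V ⊗[k] V.V) : P.constraintLin X V (P.balMkTens X V p t) =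
      crossMap X.act.toLinearMap (P.balMk V) (P.coact p) t := rfl

/-- The identity `r₍₀₎ (T(r₍₋₁₎) x ⊗ v) = x ⊗ r v`. -/
theorem insertMap_pairAct_coact {T : H →ₗ[k] H}
    (hT : ∀ h, LinearMap.mul' k H (TensorProduct.comm k H H (T.rTensor H
      (Coalgebra.comul (R := k) h))) = algebraMap k H (Coalgebra.counit h))
    (X : FDMod k H) (V : FDMod k R) (r : R) (t : X.V ⊗[k] V.V) :
    insertMap (X.act.toLinearMap ∘ₗ T)
      (pairAct X.act.toLinearMap V.act.toLinearMap ∘ₗ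
        (LeftComoduleAlgebra.coact (k := k) (H := H) (R := R)).toLinearMap)
      (LeftComoduleAlgebra.coact (k := k) (H := H) r) t = (V.act r).lTensor X.V t := by
  rw [← insertMap_lTensor]
  have h₁ := LinearMap.congr_fun (LeftComoduleAlgebra.coassoc (k := k) (H := H) (R := R)) r
  have h₂ := LinearMap.congr_fun (LeftComoduleAlgebra.counit_coact (k := k) (H := H) (R := R)) r
  have h₃ := insertMap_crossMap_comul X.act V.act.toLinearMap hT
    (LeftComoduleAlgebra.coact (k := k) (H := H) r) t
  simp only [LinearMap.comp_apply, AlgHom.toLinearMap_apply, LinearEquiv.coe_coe,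
    TensorProduct.mk_apply] at h₁ h₂
  rw [h₁, h₂, TensorProduct.lid_tmul, one_smul, crossMap_eq_pairAct] at h₃
  exact h₃

theorem insertMap_coact_right {T : H →ₗ[k] H}
    (hT₂ : ∀ h, LinearMap.mul' k H (TensorProduct.comm k H H (T.rTensor H
      (Coalgebra.comul (R := k) h))) = algebraMap k H (Coalgebra.counit h))
    (hT₃ : ∀ g h, T (g * h) = T h * T g)
    (P : EquivariantBimod k H S R) (X : FDMod k H) (V : FDMod k R) (p : P.V) (r : R)
    (t : X.V ⊗[k] V.V) :
    insertMap (X.act.toLinearMap ∘ₗ T) (P.balMkTens X V)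
        (P.coact (P.right (MulOpposite.op r) p)) t =
      insertMap (X.act.toLinearMap ∘ₗ T) (P.balMkTens X V) (P.coact p)
        ((V.act r).lTensor X.V t) := by
  rw [P.coact_right]
  apply insertMap_pairAct_right (hT := hT₃) (hz := insertMap_pairAct_coact hT₂ X V r)
  exact fun p r t => P.balMkTens_right X V p r t

noncomputable instance oplaxTensor (P : EquivariantBimod k H S R) :
    ((tensorFunctor k H S R).obj P).OplaxLeftLinear (FDMod k H) where
  δₗ X V := P.constraint X V
  δₗ_naturality_left {X X'} f V := by
    apply FDMod.hom_ext
    refine balTensor_ext (V := X ⊙ₗ V) fun p t => ?_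
    have h := crossMap_map X.act.toLinearMap X'.act.toLinearMap (P.balMk V) (P.balMk V) f.lin
      LinearMap.id LinearMap.id LinearMap.id f.comm (fun p v => rfl) (P.coact p) t
    rw [LinearMap.lTensor_id] at h
    exact h
  δₗ_naturality_right X {V V'} g := by
    apply FDMod.hom_ext
    refine balTensor_ext (V := X ⊙ₗ V) fun p t => ?_
    have h := crossMap_map X.act.toLinearMap X.act.toLinearMap (P.balMk V) (P.balMk V')
      LinearMap.id g.lin (balMap (P := P) (Q := P) LinearMap.id (fun _ _ => rfl) g) LinearMap.id
      (fun _ _ => rfl) (fun p v => rfl) (P.coact p) t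
    rw [LinearMap.lTensor_id] at h
    exact h
  δₗ_associativity X Y V := by
    apply FDMod.hom_ext
    refine balTensor_ext (V := (X ⊗ Y) ⊙ₗ V) fun p t => ?_
    have h₁ := crossMap_crossMap_assoc X.act.toLinearMap Y.act.toLinearMap (P.balMk V)
      (Coalgebra.comul (R := k) (A := H)) (P.coact p) t
    have h₂ := crossMap_lTensor X.act.toLinearMap (P.balMk (Y ⊙ₗ V))
      (crossMap Y.act.toLinearMap (P.balMk V)) (P.constraintLin Y V)
      P.coact (fun p v => rfl) (P.coact p) (TensorProduct.assoc k X.V Y.V V.V t)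
    rw [coassoc_apply] at h₁
    exact h₁.trans h₂
  δₗ_unitality_inv V := by
    apply FDMod.hom_ext
    refine balTensor_ext (V := V) fun p v => ?_
    have h := crossMap_scalar (Coalgebra.counit (R := k) (A := H)) (P.balMk V) (P.coact p) v
    rw [counit_coact_apply] at h
    exact h.symm

theorem tensorFunctor_additive (P : EquivariantBimod k H S R) :
    ((tensorFunctor k H S R).obj P).Additive where
  map_add {V W f g} := by
    apply FDMod.hom_ext
    refine balTensor_ext fun p v => ?_
    show P.balMk W p (f.lin v + g.lin v) = P.balMk W p (f.lin v) + P.balMk W p (g.lin v)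
    exact map_add _ _ _

theorem tensorFunctor_linear (P : EquivariantBimod k H S R) :
    letI := P.tensorFunctor_additive
    ((tensorFunctor k H S R).obj P).Linear k :=
  letI := P.tensorFunctor_additive
  { map_smul := fun {V W} f c => by
      apply FDMod.hom_ext
      refine balTensor_ext fun p v => ?_
      show P.balMk W p (c • f.lin v) = c • P.balMk W p (f.lin v)
      exact map_smul _ _ _ }

end

end EquivariantBimod

namespace FDMod

variable {k : Type u} [Field k] {A : Type u} [Ring A] [Algebra k A]

theorem isIso_of_bijective {X Y : FDMod k A} (f : X ⟶ Y) (hf : Function.Bijective f.lin) :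
    IsIso f :=
  (isoMk (LinearEquiv.ofBijective f.lin hf) f.comm).isIso_hom

end FDMod

namespace EquivariantBimod

section Inverse

variable {k : Type u} [Field k] {H : Type u} [Ring H] [HopfAlgebra k H] [Module.Finite k H]
  {S R : Type u} [Ring S] [Algebra k S] [Ring R] [Algebra k R]
  [LeftComoduleAlgebra k H S] [LeftComoduleAlgebra k H R]

/-- The inverse of the constraint is `x ⊗ (p ⊗_R v) ↦ p₍₀₎ ⊗_R (T(p₍₋₁₎) x ⊗ v)`, where `T` is
the inverse of the antipode. -/
theorem constraintLin_bijective (P : EquivariantBimod k H S R) (X : FDMod k H) (V : FDMod k R) :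
    Function.Bijective (P.constraintLin X V) := by
  obtain ⟨T, hT₁, hT₂, hT₃⟩ := exists_skew_antipode (k := k) (H := H)
  have hb : ∀ (p : P.V) (r : R) (t : X.V ⊗[k] V.V),
      (insertMap (X.act.toLinearMap ∘ₗ T) (P.balMkTens X V) ∘ₗ P.coact)
        (P.right (MulOpposite.op r) p) t =
      (insertMap (X.act.toLinearMap ∘ₗ T) (P.balMkTens X V) ∘ₗ P.coact) p
        ((V.act r).lTensor X.V t) :=
    fun p r t => insertMap_coact_right hT₂ hT₃ P X V p r t
  obtain ⟨D, hD⟩ := exists_lift_tmul_balMk _ hb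
  refine Function.bijective_iff_has_inverse.2 ⟨D, ?_, ?_⟩
  · have h : ∀ (p : P.V) (t : X.V ⊗[k] V.V),
        D (P.constraintLin X V (P.balMkTens X V p t)) = P.balMkTens X V p t := fun p t => ?_
    · exact LinearMap.congr_fun (f := D ∘ₗ P.constraintLin X V) (g := LinearMap.id)
        (balTensor_ext (V := X ⊙ₗ V) h)
    rw [constraintLin_balMkTens, apply_crossMap X.act.toLinearMap (P.balMk V) _ D hD,
      ← insertMap_lTensor,
      ← coassoc_apply, insertMap_insertMap_comul X.act _ hT₁ (P.coact p) t,
      counit_coact_apply, TensorProduct.lid_tmul, one_smul]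
  · intro t
    refine LinearMap.congr_fun (f := P.constraintLin X V ∘ₗ D) (g := LinearMap.id)
      (TensorProduct.ext' fun x s => ?_) t
    refine LinearMap.congr_fun (f := P.constraintLin X V ∘ₗ D ∘ₗ TensorProduct.mk k _ _ x)
      (g := TensorProduct.mk k _ _ x) (balTensor_ext fun p v => ?_) s
    show P.constraintLin X V (D (x ⊗ₜ P.balMk V p v)) = x ⊗ₜ P.balMk V p v
    have h : (P.balMkTens X V).compr₂ (P.constraintLin X V) =
        crossMap X.act.toLinearMap (P.balMk V) ∘ₗ P.coact := rfl
    rw [hD, LinearMap.comp_apply, apply_insertMap, h, ← insertMap_lTensor, ← coassoc_apply,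
      insertMap_crossMap_comul X.act _ hT₂, counit_coact_apply, TensorProduct.lid_tmul, one_smul,
      LinearMap.lTensor_tmul]

instance isIso_constraint (P : EquivariantBimod k H S R) (X : FDMod k H) (V : FDMod k R) :
    IsIso (P.constraint X V) :=
  FDMod.isIso_of_bijective _ (P.constraintLin_bijective X V)

variable (k H S R) in
/-- The functor `P ↦ (P ⊗_R -, c)`. -/
noncomputable def tensorModuleFunctor :
    EquivariantBimod k H S R ⥤ ModuleFunctor k (FDMod k H) (FDMod k R) (FDMod k S) where
  obj P :=
    letI := P.tensorFunctor_additive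
    letI := P.tensorFunctor_linear
    { F := (tensorFunctor k H S R).obj P
      isIso_c := fun X V => P.isIso_constraint X V }
  map {P Q} f :=
    { nat := (tensorFunctor k H S R).map f
      comm := fun X V => by
        apply FDMod.hom_ext
        refine balTensor_ext (V := X ⊙ₗ V) fun p t => ?_
        have h := crossMap_lTensor X.act.toLinearMap (P.balMk V) (Q.balMk V)
          (balMap f.lin f.comm_right (𝟙 V)) f.lin (fun p v => rfl) (P.coact p) t
        rw [← f.comm_coact] at h
        exact h }
  map_id P := ModuleFunctor.Hom.ext ((tensorFunctor k H S R).map_id P)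
  map_comp f g := ModuleFunctor.Hom.ext ((tensorFunctor k H S R).map_comp f g)

end Inverse

section RightExact

variable {k : Type u} [Field k] {H : Type u} [Ring H] [Bialgebra k H]
  {S R : Type u} [Ring S] [Algebra k S] [Ring R] [Algebra k R]
  [LeftComoduleAlgebra k H S] [LeftComoduleAlgebra k H R]

/-- `P ⊗_R V` is a quotient of `P ⊗ V` by a subspace that is functorial in `V` and preserves
surjections, and so the right exactness of `P ⊗ -` passes to it. -/
theorem isRightExact_tensorFunctor (P : EquivariantBimod k H S R) :
    FDMod.IsRightExact ((tensorFunctor k H S R).obj P) := by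
  intro X Y Z f g hfg hg
  have hbal : ∀ z ∈ P.balanced Z, ∃ y ∈ P.balanced Y, g.lin.lTensor P.V y = z := by
    intro z hz
    refine Submodule.span_le (p := (P.balanced Y).map (g.lin.lTensor P.V)) |>.2 ?_ hz
    rintro _ ⟨p, r, v, rfl⟩
    obtain ⟨y, rfl⟩ := hg v
    refine ⟨_, Submodule.subset_span ⟨p, r, y, rfl⟩, ?_⟩
    simp [g.comm]
  have hmk : ∀ {V W : FDMod k R} (h : V ⟶ W) (t : P.V ⊗[k] V.V),
      (((tensorFunctor k H S R).obj P).map h).lin ((P.balanced V).mkQ t) =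
        (P.balanced W).mkQ (h.lin.lTensor P.V t) := fun h t => rfl
  constructor
  · intro t
    constructor
    · intro ht
      obtain ⟨t, rfl⟩ := Submodule.mkQ_surjective _ t
      obtain ⟨y, hy, hyt⟩ := hbal _ ((Submodule.Quotient.mk_eq_zero _).1 ht)
      have h0 : g.lin.lTensor P.V (t - y) = 0 := by 
        rw [map_sub, sub_eq_zero]
        exact hyt.symm
      obtain ⟨x, hx⟩ := (lTensor_exact P.V hfg hg (t - y)).1 h0
      refine ⟨(P.balanced X).mkQ x, ?_⟩
      rw [hmk, hx]
      exact (Submodule.Quotient.eq _).2 (by rwa [sub_sub_cancel_left, neg_mem_iff])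
    · rintro ⟨s, rfl⟩
      obtain ⟨s, rfl⟩ := Submodule.mkQ_surjective _ s
      rw [hmk, hmk, (lTensor_exact P.V hfg hg _).2 ⟨s, rfl⟩]
      exact map_zero _
  · intro t
    obtain ⟨t, rfl⟩ := Submodule.mkQ_surjective _ t
    obtain ⟨s, rfl⟩ := LinearMap.lTensor_surjective P.V hg t
    exact ⟨(P.balanced Y).mkQ s, hmk g s⟩

end RightExact

end EquivariantBimod

/-! ### The regular module -/

namespace FDMod

section Reg

variable {k : Type u} [Field k] {A : Type u} [Ring A] [Algebra k A] [Module.Finite k A]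

variable (k A) in
/-- The algebra `A` as a left module over itself. -/
def reg : FDMod k A where
  V := A
  act := Algebra.lmul k A

variable (k A) in
/-- The unit of `A`, as the generator of the regular module. -/
def regOne : (reg k A).V := (1 : A)

theorem reg_act_regOne (a : A) : (reg k A).act a (regOne k A) = (show (reg k A).V from a) :=
  mul_one a

/-- The morphism `A → V` with `a ↦ a v`. -/
def point {V : FDMod k A} (v : V.V) : reg k A ⟶ V :=
  ⟨V.act.toLinearMap.flip v, fun a b => LinearMap.congr_fun (map_mul V.act a b) v⟩

@[simp] theorem point_lin_regOne {V : FDMod k A} (v : V.V) : (point v).lin (regOne k A) = v :=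
  LinearMap.congr_fun (map_one V.act) v

theorem reg_hom_ext {V : FDMod k A} {f g : reg k A ⟶ V}
    (h : f.lin (regOne k A) = g.lin (regOne k A)) : f = g := by
  refine hom_ext (LinearMap.ext fun a => ?_)
  have hf := f.comm (show A from a) (regOne k A)
  have hg := g.comm (show A from a) (regOne k A)
  rw [reg_act_regOne] at hf hg
  exact hf.trans ((congrArg _ h).trans hg.symm)

theorem point_comp {V W : FDMod k A} (v : V.V) (f : V ⟶ W) : point v ≫ f = point (f.lin v) := by
  apply reg_hom_ext
  simp

theorem point_regOne : point (regOne k A) = 𝟙 _ :=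
  reg_hom_ext (point_lin_regOne _)

theorem point_add {V : FDMod k A} (v w : V.V) : point (v + w) = point v + point w :=
  hom_ext (map_add V.act.toLinearMap.flip v w)

theorem point_smul {V : FDMod k A} (c : k) (v : V.V) : point (c • v) = c • point v :=
  hom_ext (map_smul V.act.toLinearMap.flip c v)

end Reg

end FDMod

/-! ### The functor `P ↦ P ⊗_R -` is fully faithful -/

namespace EquivariantBimod

section

variable {k : Type u} [Field k] {H : Type u} [Ring H] [Bialgebra k H]
  {S R : Type u} [Ring S] [Algebra k S] [Ring R] [Algebra k R]
  [LeftComoduleAlgebra k H S] [LeftComoduleAlgebra k H R]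

variable {P Q : EquivariantBimod k H S R}
  (α : (tensorFunctor k H S R).obj P ⟶ (tensorFunctor k H S R).obj Q)

/-- The component at `V` of a natural transformation `P ⊗_R - → Q ⊗_R -`, as a linear map. -/
def appLin (V : FDMod k R) : P.BalTensor V →ₗ[k] Q.BalTensor V := (α.app V).lin

theorem appLin_balMap {V W : FDMod k R} (g : V ⟶ W) (t : P.BalTensor V) :
    appLin α W (balMap (P := P) (Q := P) LinearMap.id (fun _ _ => rfl) g t) =
      balMap (P := Q) (Q := Q) LinearMap.id (fun _ _ => rfl) g (appLin α V t) :=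
  LinearMap.congr_fun (congrArg FDMod.Hom.lin (α.naturality g)) t

variable [Module.Finite k R]

/-- The isomorphism `P ⊗_R R → P`, `p ⊗_R r ↦ p r`. -/
def balRegEquiv (P : EquivariantBimod k H S R) : P.BalTensor (FDMod.reg k R) ≃ₗ[k] P.V :=
  LinearEquiv.ofLinearMap
    (balLift (V := FDMod.reg k R)
      (P.right.toLinearMap ∘ₗ (MulOpposite.opLinearEquiv k : R ≃ₗ[k] Rᵐᵒᵖ).toLinearMap).flip
      (fun p r (r' : R) => (LinearMap.congr_fun
        (map_mul P.right (MulOpposite.op r') (MulOpposite.op r)) p).symm))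
    ((P.balMk (FDMod.reg k R)).flip (FDMod.regOne k R))
    (LinearMap.ext fun p => LinearMap.congr_fun (map_one P.right) p)
    (balTensor_ext fun p r => (P.balMk_right (FDMod.reg k R) p r (FDMod.regOne k R)).trans
      (congrArg (P.balMk (FDMod.reg k R) p) (FDMod.reg_act_regOne (show R from r))))

theorem balRegEquiv_symm_apply (P : EquivariantBimod k H S R) (p : P.V) :
    P.balRegEquiv.symm p = P.balMk (FDMod.reg k R) p (FDMod.regOne k R) := rfl

/-- The linear map `P → Q` underlying a natural transformation `P ⊗_R - → Q ⊗_R -`, read off from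
its component at `R`. -/
def regComponent : P.V →ₗ[k] Q.V :=
  Q.balRegEquiv.toLinearMap ∘ₗ appLin α (FDMod.reg k R) ∘ₗ P.balRegEquiv.symm.toLinearMap

theorem symm_comp_regComponent :
    Q.balRegEquiv.symm.toLinearMap ∘ₗ regComponent α =
      appLin α (FDMod.reg k R) ∘ₗ P.balRegEquiv.symm.toLinearMap :=
  LinearMap.ext fun _ => Q.balRegEquiv.symm_apply_apply _

theorem balMk_regComponent (p : P.V) :
    Q.balMk (FDMod.reg k R) (regComponent α p) (FDMod.regOne k R) =
      appLin α (FDMod.reg k R) (P.balMk (FDMod.reg k R) p (FDMod.regOne k R)) :=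
  LinearMap.congr_fun (symm_comp_regComponent α) p

/-- A natural transformation `P ⊗_R - → Q ⊗_R -` is determined by its component at `R`, since
`p ⊗_R v` is the image of `p ⊗_R 1` under the morphism `R → V` with `1 ↦ v`. -/
theorem appLin_balMk (V : FDMod k R) (p : P.V) (v : V.V) :
    appLin α V (P.balMk V p v) = Q.balMk V (regComponent α p) v := by
  have h := appLin_balMap α (FDMod.point v) (P.balMk (FDMod.reg k R) p (FDMod.regOne k R))
  rw [← balMk_regComponent] at h
  simpa using h

theorem regComponent_left (s : S) (p : P.V) :
    regComponent α (P.left s p) = Q.left s (regComponent α p) := by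
  apply Q.balRegEquiv.symm.injective
  rw [balRegEquiv_symm_apply, balMk_regComponent]
  refine ((α.app (FDMod.reg k R)).comm s
    (P.balMk (FDMod.reg k R) p (FDMod.regOne k R))).trans ?_
  exact congrArg ((Q.tensorObj (FDMod.reg k R)).act s) (balMk_regComponent α p).symm

theorem regComponent_right (r : Rᵐᵒᵖ) (p : P.V) :
    regComponent α (P.right r p) = Q.right r (regComponent α p) := by
  apply Q.balRegEquiv.symm.injective
  rw [balRegEquiv_symm_apply, balRegEquiv_symm_apply, balMk_regComponent]
  obtain ⟨r, rfl⟩ := MulOpposite.op_surjective r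
  rw [balMk_right, appLin_balMk, balMk_right]

/-- The constraint at `H` and `R` recovers the coaction. -/
theorem crossMap_regOne [Module.Finite k H] (P : EquivariantBimod k H S R) (w : H ⊗[k] P.V) :
    crossMap (Algebra.lmul k H).toLinearMap (P.balMk (FDMod.reg k R)) w
      ((1 : H) ⊗ₜ[k] FDMod.regOne k R) = P.balRegEquiv.symm.toLinearMap.lTensor H w :=
  crossMap_lmul_one _ _ w

theorem regComponent_coact [Module.Finite k H]
    (hα : ∀ (X : FDMod k H) (V : FDMod k R),
      α.app (X ⊙ₗ V) ≫ Q.constraint X V = P.constraint X V ≫ X ⊴ₗ α.app V) (p : P.V) :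
    Q.coact (regComponent α p) = (regComponent α).lTensor H (P.coact p) := by
  have h : ∀ t : H ⊗[k] (FDMod.reg k R).V,
      crossMap (Algebra.lmul k H).toLinearMap (Q.balMk (FDMod.reg k R))
        (Q.coact (regComponent α p)) t =
      (appLin α (FDMod.reg k R)).lTensor H
        (crossMap (Algebra.lmul k H).toLinearMap (P.balMk (FDMod.reg k R)) (P.coact p) t) :=
    fun t => (congrArg (Q.constraint (FDMod.reg k H) (FDMod.reg k R)).lin
        (appLin_balMk α (FDMod.reg k H ⊙ₗ FDMod.reg k R) p t)).symm.trans
      (LinearMap.congr_fun (congrArg FDMod.Hom.lin (hα (FDMod.reg k H) (FDMod.reg k R)))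
        (P.balMk (FDMod.reg k H ⊙ₗ FDMod.reg k R) p t))
  have h1 := h ((1 : H) ⊗ₜ FDMod.regOne k R)
  rw [crossMap_regOne, crossMap_regOne, ← LinearMap.lTensor_comp_apply,
    ← symm_comp_regComponent, LinearMap.lTensor_comp_apply] at h1
  exact (Q.balRegEquiv.symm.lTensor H).injective h1

end

section

variable {k : Type u} [Field k] {H : Type u} [Ring H] [HopfAlgebra k H] [Module.Finite k H]
  {S R : Type u} [Ring S] [Algebra k S] [Ring R] [Algebra k R] [Module.Finite k R]
  [LeftComoduleAlgebra k H S] [LeftComoduleAlgebra k H R]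

instance : (tensorModuleFunctor k H S R).Full where
  map_surjective {P Q} α := by
    refine ⟨⟨regComponent (P := P) (Q := Q) α.nat, regComponent_left (P := P) (Q := Q) α.nat,
      regComponent_right (P := P) (Q := Q) α.nat,
      regComponent_coact (P := P) (Q := Q) α.nat α.comm⟩, ?_⟩
    apply ModuleFunctor.Hom.ext
    ext V : 2
    apply FDMod.hom_ext
    refine balTensor_ext fun p v => ?_
    exact (appLin_balMk (P := P) (Q := Q) α.nat V p v).symm

instance : (tensorModuleFunctor k H S R).Faithful where
  map_injective {P Q f g} h := by
    apply Hom.ext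
    ext p
    have h' := LinearMap.congr_fun (congrArg (fun α => FDMod.Hom.lin
      (NatTrans.app (ModuleFunctor.Hom.nat α) (FDMod.reg k R))) h)
      (P.balMk (FDMod.reg k R) p (FDMod.regOne k R))
    exact Q.balRegEquiv.symm.injective h'

end

end EquivariantBimod

/-! ### The equivariant bimodule of a module functor -/

namespace ModuleFunctor

section

variable {k : Type u} [Field k] {H : Type u} [Ring H] [Bialgebra k H]
  {S R : Type u} [Ring S] [Algebra k S] [Ring R] [Algebra k R]
  [LeftComoduleAlgebra k H S] [LeftComoduleAlgebra k H R]
  (G : ModuleFunctor k (FDMod k H) (FDMod k R) (FDMod k S))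

theorem map_actionHom_comp_c {X Y : FDMod k H} {V W : FDMod k R} (f : X ⟶ Y) (g : V ⟶ W) :
    G.F.map (FDMod.tensHom f g : X ⊙ₗ V ⟶ Y ⊙ₗ W) ≫ G.c Y W =
      G.c X V ≫ (FDMod.tensHom f (G.F.map g) : X ⊙ₗ G.F.obj V ⟶ Y ⊙ₗ G.F.obj W) := by
  have h₁ : (FDMod.tensHom f g : X ⊙ₗ V ⟶ Y ⊙ₗ W) = f ⊵ₗ V ≫ Y ⊴ₗ g :=
    MonoidalLeftAction.actionHom_def f g
  have h₂ : (FDMod.tensHom f (G.F.map g) : X ⊙ₗ G.F.obj V ⟶ Y ⊙ₗ G.F.obj W) =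
      f ⊵ₗ G.F.obj V ≫ Y ⊴ₗ G.F.map g :=
    MonoidalLeftAction.actionHom_def f (G.F.map g)
  rw [h₁, h₂, G.F.map_comp, Category.assoc, Functor.OplaxLeftLinear.δₗ_naturality_right,
    Functor.OplaxLeftLinear.δₗ_naturality_left_assoc]

/-- The constraint of a module functor, as a linear map. -/
noncomputable def cLin (X : FDMod k H) (V : FDMod k R) :
    (G.F.obj (X ⊙ₗ V)).V →ₗ[k] X.V ⊗[k] (G.F.obj V).V := (G.c X V).lin

variable [Module.Finite k R]

/-- The bilinear map `F(R) × V → F(V)`, `(p, v) ↦ F(r ↦ r v)(p)`. -/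
def eval (V : FDMod k R) : (G.F.obj (FDMod.reg k R)).V →ₗ[k] V.V →ₗ[k] (G.F.obj V).V :=
  (LinearMap.mk₂ k (fun v p => (G.F.map (FDMod.point v)).lin p)
    (fun v w p => by rw [FDMod.point_add, G.F.map_add]; rfl)
    (fun c v p => by rw [FDMod.point_smul, G.F.map_smul]; rfl)
    (fun v p q => map_add _ p q)
    (fun c v p => map_smul _ c p)).flip

theorem eval_apply (V : FDMod k R) (p : (G.F.obj (FDMod.reg k R)).V) (v : V.V) :
    G.eval V p v = (G.F.map (FDMod.point v)).lin p := rfl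

theorem eval_naturality {V W : FDMod k R} (g : V ⟶ W) (p : (G.F.obj (FDMod.reg k R)).V)
    (v : V.V) : G.eval W p (g.lin v) = (G.F.map g).lin (G.eval V p v) := by
  rw [eval_apply, ← FDMod.point_comp, G.F.map_comp]
  rfl

theorem eval_regOne (p : (G.F.obj (FDMod.reg k R)).V) :
    G.eval (FDMod.reg k R) p (FDMod.regOne k R) = p := by
  rw [eval_apply, FDMod.point_regOne, G.F.map_id]
  rfl

/-- For `V = R` the map `eval` is the right action of `R` on `F(R)`, so this says that `eval` is
balanced. -/
theorem eval_act (V : FDMod k R) (p : (G.F.obj (FDMod.reg k R)).V) (r : R) (v : V.V) :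
    G.eval V p (V.act r v) = G.eval V (G.eval (FDMod.reg k R) p r) v :=
  G.eval_naturality (FDMod.point v) p r

theorem eval_act_left (V : FDMod k R) (s : S) (p : (G.F.obj (FDMod.reg k R)).V) (v : V.V) :
    G.eval V ((G.F.obj (FDMod.reg k R)).act s p) v = (G.F.obj V).act s (G.eval V p v) :=
  (G.F.map (FDMod.point v)).comm s p

variable [Module.Finite k H]

/-- The element `1 ⊗ 1` of `H ⊗ R`. The morphism `point` that it defines is the coaction
`R → H ⊗ R`. -/
noncomputable def _root_.FDMod.oneTmulOne (k H R : Type u) [Field k] [Ring H] [Bialgebra k H]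
    [Module.Finite k H] [Ring R] [Algebra k R] [Module.Finite k R] [LeftComoduleAlgebra k H R] :
    (FDMod.reg k H ⊙ₗ FDMod.reg k R).V :=
  FDMod.regOne k H ⊗ₜ[k] FDMod.regOne k R

/-- The coaction of `F(R)`: the constraint at `H` and `R` after the image under `F` of the
coaction `R → H ⊗ R`, which is `r ↦ r (1 ⊗ 1)`. -/
noncomputable def coactLin :
    (G.F.obj (FDMod.reg k R)).V →ₗ[k] H ⊗[k] (G.F.obj (FDMod.reg k R)).V :=
  G.cLin (FDMod.reg k H) (FDMod.reg k R) ∘ₗ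
    (G.eval (FDMod.reg k H ⊙ₗ FDMod.reg k R)).flip (FDMod.oneTmulOne k H R)

/-- `coactLin` as a morphism of `S`-modules. -/
noncomputable def coactHom :
    G.F.obj (FDMod.reg k R) ⟶ (FDMod.reg k H ⊙ₗ G.F.obj (FDMod.reg k R) : FDMod k S) :=
  G.F.map (FDMod.point (FDMod.oneTmulOne k H R)) ≫ G.c (FDMod.reg k H) (FDMod.reg k R)

/-- The constraint is determined by the coaction:
`c(F(r ↦ r (x ⊗ v))(p)) = p₍₋₁₎ x ⊗ F(r ↦ r v)(p₍₀₎)`. This holds because `r ↦ r (x ⊗ v)` is the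
composite of the coaction `R → H ⊗ R` and of `h ⊗ r ↦ h x ⊗ r v`. -/
theorem cLin_eval (X : FDMod k H) (V : FDMod k R) (p : (G.F.obj (FDMod.reg k R)).V)
    (t : X.V ⊗[k] V.V) : G.cLin X V (G.eval (X ⊙ₗ V) p t) =
      crossMap X.act.toLinearMap (G.eval V) (G.coactLin p) t := by
  have key : ((G.eval (X ⊙ₗ V)).compr₂ (G.cLin X V) p : X.V ⊗[k] V.V →ₗ[k] _) =
      crossMap X.act.toLinearMap (G.eval V) (G.coactLin p) := by
    refine TensorProduct.ext' fun x v => ?_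
    have h₂ : (FDMod.tensHom (FDMod.point x) (FDMod.point v) :
        FDMod.reg k H ⊙ₗ FDMod.reg k R ⟶ X ⊙ₗ V).lin (FDMod.oneTmulOne k H R) = x ⊗ₜ[k] v :=
      congrArg₂ (· ⊗ₜ[k] ·) (FDMod.point_lin_regOne x) (FDMod.point_lin_regOne v)
    have h₃ := G.eval_naturality (FDMod.tensHom (FDMod.point x) (FDMod.point v) :
        FDMod.reg k H ⊙ₗ FDMod.reg k R ⟶ X ⊙ₗ V) p (FDMod.oneTmulOne k H R)
    have h₄ := LinearMap.congr_fun (congrArg FDMod.Hom.lin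
      (G.map_actionHom_comp_c (FDMod.point x) (FDMod.point v)))
      (G.eval (FDMod.reg k H ⊙ₗ FDMod.reg k R) p (FDMod.oneTmulOne k H R))
    rw [crossMap_flip_tmul]
    exact (congrArg (G.cLin X V) ((congrArg (G.eval (X ⊙ₗ V) p) h₂.symm).trans h₃)).trans h₄
  exact LinearMap.congr_fun key t

theorem coactLin_left (s : S) (p : (G.F.obj (FDMod.reg k R)).V) :
    G.coactLin ((G.F.obj (FDMod.reg k R)).act s p) =
      pairAct (LinearMap.mul k H) (G.F.obj (FDMod.reg k R)).act.toLinearMap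
        (LeftComoduleAlgebra.coact (k := k) (H := H) s) (G.coactLin p) :=
  G.coactHom.comm s p

/-- The right action of `R` on `F(R)` is the image under `F` of right multiplication. -/
def rightAct : Rᵐᵒᵖ →ₐ[k] Module.End k (G.F.obj (FDMod.reg k R)).V :=
  AlgHom.ofLinearMap
    ((G.eval (FDMod.reg k R)).flip ∘ₗ (MulOpposite.opLinearEquiv k : R ≃ₗ[k] Rᵐᵒᵖ).symm.toLinearMap)
    (LinearMap.ext fun p => G.eval_regOne p)
    (fun r s => LinearMap.ext fun p =>
      G.eval_act (FDMod.reg k R) p s.unop r.unop)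

theorem coactLin_right (r : R) (p : (G.F.obj (FDMod.reg k R)).V) :
    G.coactLin (G.rightAct (MulOpposite.op r) p) =
      pairAct (LinearMap.mul k H).flip
        (G.rightAct.toLinearMap ∘ₗ (MulOpposite.opLinearEquiv k).toLinearMap)
        (LeftComoduleAlgebra.coact (k := k) (H := H) r) (G.coactLin p) := by
  have h₁ : (FDMod.reg k H ⊙ₗ FDMod.reg k R).act r (FDMod.oneTmulOne k H R) =
      LeftComoduleAlgebra.coact (k := k) (H := H) r := pairAct_lmul_one_tmul_one _
  have h₂ := G.eval_act (FDMod.reg k H ⊙ₗ FDMod.reg k R) p r (FDMod.oneTmulOne k H R)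
  have h₃ := G.cLin_eval (FDMod.reg k H) (FDMod.reg k R) p
    (LeftComoduleAlgebra.coact (k := k) (H := H) (R := R) r)
  have h₄ := crossMap_lmul (G.eval (FDMod.reg k R))
    (LeftComoduleAlgebra.coact (k := k) (H := H) (R := R) r) (G.coactLin p)
  exact (congrArg (G.cLin (FDMod.reg k H) (FDMod.reg k R))
    ((congrArg _ h₁.symm).trans h₂)).symm.trans (h₃.trans h₄)

theorem counit_coactLin (p : (G.F.obj (FDMod.reg k R)).V) :
    (Coalgebra.counit (R := k) (A := H)).rTensor _ (G.coactLin p) = (1 : k) ⊗ₜ p := by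
  have h₁ := G.cLin_eval (FDMod.triv k H) (FDMod.reg k R) p ((1 : k) ⊗ₜ FDMod.regOne k R)
  have h₂ := crossMap_scalar (Coalgebra.counit (R := k) (A := H)) (G.eval (FDMod.reg k R))
    (G.coactLin p) (FDMod.regOne k R)
  have h₃ : (G.eval (FDMod.reg k R)).flip (FDMod.regOne k R) = LinearMap.id :=
    LinearMap.ext fun p => G.eval_regOne p
  rw [h₃, LinearMap.lTensor_id] at h₂
  have h₄ := LinearMap.congr_fun (congrArg FDMod.Hom.lin
    (Functor.OplaxLeftLinear.δₗ_unitality_inv (F := G.F) (C := FDMod k H) (FDMod.reg k R))) p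
  have h₅ := G.eval_naturality (FDMod.lunit (H := H) (FDMod.reg k R)).inv p (FDMod.regOne k R)
  rw [eval_regOne] at h₅
  exact (h₂.symm.trans h₁.symm).trans
    ((congrArg (G.cLin (FDMod.triv k H) (FDMod.reg k R)) h₅).trans h₄.symm)

theorem coassoc_coactLin (p : (G.F.obj (FDMod.reg k R)).V) :
    TensorProduct.assoc k H H _ ((Coalgebra.comul (R := k) (A := H)).rTensor _ (G.coactLin p)) =
      G.coactLin.lTensor H (G.coactLin p) := by
  let X := FDMod.reg k H
  let V := FDMod.reg k R
  -- Evaluation at `1 ⊗ (1 ⊗ 1)` is the identity.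
  have hone : ∀ u : H ⊗[k] (H ⊗[k] (G.F.obj V).V),
      crossMap (Algebra.lmul k H).toLinearMap
        (crossMap (Algebra.lmul k H).toLinearMap (G.eval V)) u
        ((1 : H) ⊗ₜ ((1 : H) ⊗ₜ FDMod.regOne k R)) = u := by
    intro u
    have h : (crossMap (Algebra.lmul k H).toLinearMap (G.eval V)).flip
        ((1 : H) ⊗ₜ FDMod.regOne k R) = LinearMap.id := by
      refine LinearMap.ext fun w => ?_
      have h' : (G.eval V).flip (FDMod.regOne k R) = LinearMap.id :=
        LinearMap.ext fun p => G.eval_regOne p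
      rw [LinearMap.flip_apply, crossMap_lmul_one, h', LinearMap.lTensor_id]
    rw [crossMap_lmul_one, h, LinearMap.lTensor_id, LinearMap.id_apply]
  let t : (H ⊗[k] H) ⊗[k] V.V := ((1 : H) ⊗ₜ (1 : H)) ⊗ₜ FDMod.regOne k R
  have h₁ := crossMap_crossMap_assoc (Algebra.lmul k H).toLinearMap (Algebra.lmul k H).toLinearMap
    (G.eval V) (Coalgebra.comul (R := k) (A := H)) (G.coactLin p) t
  have h₂ := G.cLin_eval (X ⊗ X) V p t
  have h₃ := LinearMap.congr_fun (congrArg FDMod.Hom.lin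
    (Functor.OplaxLeftLinear.δₗ_associativity (F := G.F) X X V)) (G.eval ((X ⊗ X) ⊙ₗ V) p t)
  have h₄ := G.eval_naturality (FDMod.assocIso X X V).hom p t
  have h₅ := G.cLin_eval X (X ⊙ₗ V) p ((1 : H) ⊗ₜ ((1 : H) ⊗ₜ FDMod.regOne k R))
  have h₆ := crossMap_lTensor (Algebra.lmul k H).toLinearMap (G.eval (X ⊙ₗ V))
    (crossMap (Algebra.lmul k H).toLinearMap (G.eval V)) (G.cLin X V) G.coactLin
    (fun q t => (G.cLin_eval X V q t).symm) (G.coactLin p)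
    ((1 : H) ⊗ₜ ((1 : H) ⊗ₜ FDMod.regOne k R))
  have e₁ := (congrArg (TensorProduct.assoc k H H (G.F.obj V).V) h₂).trans
    (h₁.trans (hone _))
  have e₂ := (congrArg ((G.cLin X V).lTensor H)
    ((congrArg (G.cLin X (X ⊙ₗ V)) h₄.symm).trans h₅)).trans (h₆.symm.trans (hone _))
  exact e₁.symm.trans (h₃.trans e₂)

/-- The equivariant bimodule `F(R)` of a module functor `F`. -/
noncomputable def bimod : EquivariantBimod k H S R where
  V := (G.F.obj (FDMod.reg k R)).V
  left := (G.F.obj (FDMod.reg k R)).act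
  right := G.rightAct
  left_right s r p := (G.eval_act_left (FDMod.reg k R) s p r.unop).symm
  coact := G.coactLin
  coassoc := LinearMap.ext G.coassoc_coactLin
  counit_coact := LinearMap.ext G.counit_coactLin
  coact_left := G.coactLin_left
  coact_right := G.coactLin_right

end

end ModuleFunctor

/-! ### Right exact module functors are tensor functors -/

namespace FDMod

section

variable {k : Type u} [Field k] {A : Type u} [Ring A] [Algebra k A]

/-- The kernel of a morphism. -/
def kernel {X Y : FDMod k A} (f : X ⟶ Y) : FDMod k A where
  V := LinearMap.ker f.lin
  act := AlgHom.ofLinearMap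
    { toFun := fun a => (X.act a).restrict (p := LinearMap.ker f.lin) (q := LinearMap.ker f.lin)
        (fun x hx => by rw [LinearMap.mem_ker] at hx ⊢; rw [f.comm, hx, map_zero])
      map_add' := fun a b => LinearMap.ext fun x => Subtype.ext (by simp)
      map_smul' := fun c a => LinearMap.ext fun x => Subtype.ext (by simp) }
    (LinearMap.ext fun x => Subtype.ext (by simp))
    (fun a b => LinearMap.ext fun x => Subtype.ext (by simp))

/-- The inclusion of the kernel. -/
def kernelι {X Y : FDMod k A} (f : X ⟶ Y) : kernel f ⟶ X :=
  ⟨(LinearMap.ker f.lin).subtype, fun _ _ => rfl⟩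

theorem kernelι_exact {X Y : FDMod k A} (f : X ⟶ Y) :
    Function.Exact (kernelι f).lin f.lin := fun x =>
  ⟨fun hx => ⟨⟨x, hx⟩, rfl⟩, fun ⟨y, hy⟩ => hy ▸ y.2⟩

theorem sum_lin {ι : Type*} {X Y : FDMod k A} (s : Finset ι) (f : ι → (X ⟶ Y)) :
    (∑ i ∈ s, f i).lin = ∑ i ∈ s, (f i).lin :=
  map_sum ({ toFun := fun f : X ⟶ Y => f.lin, map_zero' := rfl, map_add' := fun _ _ => rfl } :
    (X ⟶ Y) →+ (X.V →ₗ[k] Y.V)) f s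

variable [Module.Finite k A]

variable (k A) in
/-- The free module of rank `n`. -/
def free (n : ℕ) : FDMod k A where
  V := Fin n → A
  act := Algebra.lsmul k k (Fin n → A)

/-- The inclusion of the `i`-th summand of a free module. -/
def freeι {n : ℕ} (i : Fin n) : reg k A ⟶ free k A n :=
  ⟨LinearMap.single k (fun _ : Fin n => A) i, fun a b => by
    funext j
    exact congrFun (Pi.single_smul (f := fun _ : Fin n => A) i a (show A from b)) j⟩

/-- The projection onto the `i`-th summand of a free module. -/
def freeπ {n : ℕ} (i : Fin n) : free k A n ⟶ reg k A :=
  ⟨LinearMap.proj (φ := fun _ : Fin n => A) i, fun _ _ => rfl⟩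

theorem sum_freeπ_freeι (n : ℕ) : ∑ i, freeπ (k := k) (A := A) i ≫ freeι i = 𝟙 (free k A n) := by
  apply hom_ext
  rw [sum_lin]
  refine LinearMap.ext fun v => ?_
  rw [LinearMap.sum_apply]
  exact Finset.univ_sum_single (show Fin n → A from v)

/-- Every finite-dimensional module is a quotient of a free module of finite rank. -/
theorem exists_free_surjective (V : FDMod k A) :
    ∃ (n : ℕ) (g : free k A n ⟶ V), Function.Surjective g.lin := by
  obtain ⟨n, v, hv⟩ := Module.Finite.exists_fin (R := k) (M := V.V)
  refine ⟨n, ∑ i, freeπ i ≫ point (v i), ?_⟩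
  rw [← LinearMap.range_eq_top, eq_top_iff, ← hv, Submodule.span_le]
  rintro _ ⟨i, rfl⟩
  refine ⟨(freeι i).lin (regOne k A), ?_⟩
  rw [sum_lin, LinearMap.sum_apply, Finset.sum_eq_single i]
  · have h : (freeπ i).lin ((freeι i).lin (regOne k A)) = regOne k A :=
      Pi.single_eq_same (M := fun _ : Fin n => A) i 1
    rw [comp_lin, LinearMap.comp_apply, h, point_lin_regOne]
  · intro j _ hj
    have h : (freeπ j).lin ((freeι i).lin (regOne k A)) = 0 :=
      Pi.single_eq_of_ne (M := fun _ : Fin n => A) hj 1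
    rw [comp_lin, LinearMap.comp_apply, h, map_zero]
  · intro h
    exact absurd (Finset.mem_univ i) h

end

end FDMod

namespace ModuleFunctor

open EquivariantBimod

section

variable {k : Type u} [Field k] {H : Type u} [Ring H] [Bialgebra k H] [Module.Finite k H]
  {S R : Type u} [Ring S] [Algebra k S] [Ring R] [Algebra k R] [Module.Finite k R]
  [LeftComoduleAlgebra k H S] [LeftComoduleAlgebra k H R]
  (G : ModuleFunctor k (FDMod k H) (FDMod k R) (FDMod k S))

/-- The bilinear map `F(R) × V → F(R) ⊗_R V`. -/
noncomputable def bimodMk (V : FDMod k R) :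
    (G.F.obj (FDMod.reg k R)).V →ₗ[k] V.V →ₗ[k] G.bimod.BalTensor V :=
  G.bimod.balMk V

theorem bimodMk_eval (V : FDMod k R) (p : (G.F.obj (FDMod.reg k R)).V) (r : R) (v : V.V) :
    G.bimodMk V (G.eval (FDMod.reg k R) p r) v = G.bimodMk V p (V.act r v) :=
  G.bimod.balMk_right V p r v

/-- The map `F(R) ⊗_R V → F(V)` induced by `eval`. -/
noncomputable def evalLin (V : FDMod k R) : G.bimod.BalTensor V →ₗ[k] (G.F.obj V).V :=
  balLift (P := G.bimod) (G.eval V) (fun p r v => (G.eval_act V p r v).symm)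

theorem evalLin_bimodMk (V : FDMod k R) (p : (G.F.obj (FDMod.reg k R)).V) (v : V.V) :
    G.evalLin V (G.bimodMk V p v) = G.eval V p v := rfl

theorem evalLin_naturality {V W : FDMod k R} (g : V ⟶ W) (t : G.bimod.BalTensor V) :
    G.evalLin W ((((tensorFunctor k H S R).obj G.bimod).map g).lin t) =
      (G.F.map g).lin (G.evalLin V t) := by
  have h : G.evalLin W ∘ₗ balMap (P := G.bimod) (Q := G.bimod) LinearMap.id (fun _ _ => rfl) g =
      (G.F.map g).lin ∘ₗ G.evalLin V :=
    balTensor_ext fun p v => G.eval_naturality g p v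
  exact LinearMap.congr_fun h t

/-- The natural transformation `F(R) ⊗_R - → F`. -/
noncomputable def evalNat : (tensorFunctor k H S R).obj G.bimod ⟶ G.F where
  app V := ⟨G.evalLin V, fun s => LinearMap.congr_fun
    (f := G.evalLin V ∘ₗ (G.bimod.tensorObj V).act s) (g := (G.F.obj V).act s ∘ₗ G.evalLin V)
    (balTensor_ext fun p v => G.eval_act_left V s p v)⟩
  naturality _ _ g := FDMod.hom_ext (LinearMap.ext fun t => G.evalLin_naturality g t)

theorem evalNat_comm (X : FDMod k H) (V : FDMod k R) :
    G.evalNat.app (X ⊙ₗ V) ≫ G.c X V = G.bimod.constraint X V ≫ X ⊴ₗ G.evalNat.app V := by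
  apply FDMod.hom_ext
  refine balTensor_ext (V := X ⊙ₗ V) fun p t => ?_
  have h := crossMap_lTensor X.act.toLinearMap (G.bimodMk V) (G.eval V) (G.evalLin V)
    LinearMap.id (fun p v => rfl) (G.coactLin p) t
  rw [LinearMap.lTensor_id] at h
  exact (G.cLin_eval X V p t).trans h

/-- On a free module the inverse of `evalLin` is `y ↦ ∑ i, F(π i)(y) ⊗ e i`. -/
theorem evalLin_free_bijective (n : ℕ) : Function.Bijective (G.evalLin (FDMod.free k R n)) := by
  let V := FDMod.free k R n
  let e : Fin n → V.V := fun i => (FDMod.freeι i).lin (FDMod.regOne k R)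
  have he : ∀ i, FDMod.point (e i) = FDMod.freeι i := fun i => by
    rw [← FDMod.point_comp, FDMod.point_regOne, Category.id_comp]
  have hsum : ∀ v : V.V, ∑ i, V.act (show R from (FDMod.freeπ i).lin v) (e i) = v := by
    intro v
    have h := LinearMap.congr_fun
      (congrArg FDMod.Hom.lin (FDMod.sum_freeπ_freeι (k := k) (A := R) n)) v
    rw [FDMod.sum_lin, LinearMap.sum_apply] at h
    refine Eq.trans (Finset.sum_congr rfl fun i _ => ?_) h
    rw [← he]
    rfl
  let D : (G.F.obj V).V →ₗ[k] G.bimod.BalTensor V :=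
    ∑ i, (G.bimodMk V).flip (e i) ∘ₗ (G.F.map (FDMod.freeπ i)).lin
  have hD : ∀ y, D y = ∑ i, G.bimodMk V ((G.F.map (FDMod.freeπ i)).lin y) (e i) := fun y =>
    LinearMap.sum_apply _ _ _
  refine Function.bijective_iff_has_inverse.2 ⟨D, ?_, ?_⟩
  · have h : ∀ (p : (G.F.obj (FDMod.reg k R)).V) (v : V.V),
        D (G.evalLin V (G.bimodMk V p v)) = G.bimodMk V p v := by
      intro p v
      rw [evalLin_bimodMk, hD]
      conv_rhs => rw [← hsum v, map_sum]
      refine Finset.sum_congr rfl fun i _ => ?_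
      rw [← G.eval_naturality, ← bimodMk_eval]
    exact LinearMap.congr_fun (f := D ∘ₗ G.evalLin _) (g := LinearMap.id) (balTensor_ext h)
  · intro y
    have h₂ : ∑ i, (G.F.map (FDMod.freeπ i) ≫ G.F.map (FDMod.freeι i)) = 𝟙 (G.F.obj V) := by
      rw [← G.F.map_id, ← FDMod.sum_freeπ_freeι, G.F.map_sum]
      simp only [G.F.map_comp]
    have h₃ := LinearMap.congr_fun (congrArg FDMod.Hom.lin h₂) y
    rw [FDMod.sum_lin, LinearMap.sum_apply] at h₃
    rw [hD, map_sum]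
    refine Eq.trans (Finset.sum_congr rfl fun i _ => ?_) h₃
    rw [evalLin_bimodMk, eval_apply, he]
    rfl

variable {G}

theorem evalLin_bijective (hG : FDMod.IsRightExact G.F) (V : FDMod k R) :
    Function.Bijective (G.evalLin V) := by
  have hsurj : ∀ V : FDMod k R, Function.Surjective (G.evalLin V) := by
    intro V y
    obtain ⟨n, g, hg⟩ := FDMod.exists_free_surjective V
    obtain ⟨y, rfl⟩ := (hG _ g (FDMod.kernelι_exact g) hg).2 y
    obtain ⟨t, rfl⟩ := (G.evalLin_free_bijective n).2 y
    exact ⟨_, G.evalLin_naturality g t⟩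
  refine ⟨?_, hsurj V⟩
  rw [injective_iff_map_eq_zero]
  intro t ht
  obtain ⟨n, g, hg⟩ := FDMod.exists_free_surjective V
  have hP := isRightExact_tensorFunctor G.bimod (FDMod.kernelι g) g (FDMod.kernelι_exact g) hg
  obtain ⟨t, rfl⟩ := hP.2 t
  have ht' := (G.evalLin_naturality g t).symm.trans ht
  obtain ⟨y, hy⟩ := ((hG _ g (FDMod.kernelι_exact g) hg).1 _).1 ht'
  obtain ⟨s, rfl⟩ := hsurj _ y
  have hs := (G.evalLin_naturality (FDMod.kernelι g) s).trans hy
  exact (hP.1 t).2 ⟨s, (G.evalLin_free_bijective n).1 hs⟩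

end

theorem isIso_of_isIso_nat {k C D D' : Type*} [Field k] [Category* C] [Category* D]
    [Category* D'] [MonoidalCategory C] [Preadditive D] [Linear k D] [Preadditive D']
    [Linear k D'] [MonoidalLeftAction C D] [MonoidalLeftAction C D']
    {F G : ModuleFunctor k C D D'} (α : F ⟶ G)
    [IsIso α.nat] : IsIso α := by
  refine ⟨⟨inv α.nat, fun X M => ?_⟩, ModuleFunctor.Hom.ext (IsIso.hom_inv_id α.nat),
    ModuleFunctor.Hom.ext (IsIso.inv_hom_id α.nat)⟩
  have h := α.comm X M
  rw [NatIso.isIso_inv_app, NatIso.isIso_inv_app, IsIso.inv_comp_eq, ← Category.assoc, h,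
    Category.assoc, ← MonoidalLeftAction.actionHomRight_comp, IsIso.hom_inv_id,
    MonoidalLeftAction.actionHomRight_id, Category.comp_id]

section

variable {k : Type u} [Field k] {H : Type u} [Ring H] [HopfAlgebra k H] [Module.Finite k H]
  {S R : Type u} [Ring S] [Algebra k S] [Ring R] [Algebra k R] [Module.Finite k R]
  [LeftComoduleAlgebra k H S] [LeftComoduleAlgebra k H R]
  (G : ModuleFunctor k (FDMod k H) (FDMod k R) (FDMod k S))

/-- The morphism of module functors `F(R) ⊗_R - → F`. -/
noncomputable def evalHom : (tensorModuleFunctor k H S R).obj G.bimod ⟶ G where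
  nat := G.evalNat
  comm := G.evalNat_comm

theorem isIso_evalHom (hG : FDMod.IsRightExact G.F) : IsIso G.evalHom := by
  have : IsIso G.evalHom.nat := by
    have : ∀ V, IsIso (G.evalNat.app V) := fun V =>
      FDMod.isIso_of_bijective _ (evalLin_bijective hG V)
    exact NatIso.isIso_of_isIso_app G.evalNat
  exact isIso_of_isIso_nat _

end

end ModuleFunctor

/-! ### Module functors on an exact module category are right exact -/

namespace FDMod

section

variable {k : Type u} [Field k] {A : Type u} [Ring A] [Algebra k A]

theorem epi_of_surjective {X Y : FDMod k A} (f : X ⟶ Y) (hf : Function.Surjective f.lin) :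
    Epi f :=
  ⟨fun g h hgh => hom_ext (LinearMap.ext fun y => by
    obtain ⟨x, rfl⟩ := hf y
    exact LinearMap.congr_fun (congrArg Hom.lin hgh) x)⟩

/-- The cokernel of a morphism. -/
def cokernel {X Y : FDMod k A} (f : X ⟶ Y) : FDMod k A where
  V := Y.V ⧸ LinearMap.range f.lin
  act := AlgHom.ofLinearMap
    { toFun := fun a => (LinearMap.range f.lin).mapQ (LinearMap.range f.lin) (Y.act a) (by
        rintro _ ⟨x, rfl⟩
        exact ⟨X.act a x, f.comm a x⟩)
      map_add' := fun a b => Submodule.linearMap_qext _ (LinearMap.ext fun y => by simp)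
      map_smul' := fun c a => Submodule.linearMap_qext _ (LinearMap.ext fun y => by simp) }
    (Submodule.linearMap_qext _ (LinearMap.ext fun y => by simp))
    (fun a b => Submodule.linearMap_qext _ (LinearMap.ext fun y => by simp))

/-- The projection onto the cokernel. -/
def cokernelπ {X Y : FDMod k A} (f : X ⟶ Y) : Y ⟶ cokernel f :=
  ⟨(LinearMap.range f.lin).mkQ, fun _ _ => rfl⟩

theorem surjective_of_epi {X Y : FDMod k A} (f : X ⟶ Y) [Epi f] :
    Function.Surjective f.lin := by
  have h : cokernelπ f = 0 := by
    rw [← cancel_epi f]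
    refine hom_ext (LinearMap.ext fun x => ?_)
    exact (Submodule.Quotient.mk_eq_zero _).2 ⟨x, rfl⟩
  intro y
  exact (Submodule.Quotient.mk_eq_zero _).1 (LinearMap.congr_fun (congrArg Hom.lin h) y)

instance projective_reg [Module.Finite k A] : Projective (reg k A) where
  factors {E X} f e _ := by
    obtain ⟨v, hv⟩ := surjective_of_epi e (f.lin (regOne k A))
    refine ⟨point v, reg_hom_ext ?_⟩
    rw [point_comp, point_lin_regOne, hv]

/-- A morphism out of a projective module whose image lies in the image of `f` factors through
`f`. -/
theorem exists_lift_of_projective {P X Y Z : FDMod k A} [Projective P] (u : P ⟶ Y) (f : X ⟶ Y)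
    (g : Y ⟶ Z) (hfg : Function.Exact f.lin g.lin) (hu : u ≫ g = 0) : ∃ t : P ⟶ X, t ≫ f = u := by
  let f' : X ⟶ kernel g :=
    ⟨f.lin.codRestrict _ (fun x => (hfg _).2 ⟨x, rfl⟩), fun a x => Subtype.ext (f.comm a x)⟩
  let u' : P ⟶ kernel g :=
    ⟨u.lin.codRestrict _ (fun x => LinearMap.congr_fun (congrArg Hom.lin hu) x),
      fun a x => Subtype.ext (u.comm a x)⟩
  have : Epi f' := epi_of_surjective f' (fun ⟨y, hy⟩ => by
    obtain ⟨x, rfl⟩ := (hfg y).1 hy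
    exact ⟨x, rfl⟩)
  refine ⟨Projective.factorThru u' f', ?_⟩
  calc Projective.factorThru u' f' ≫ f = (Projective.factorThru u' f' ≫ f') ≫ kernelι g := rfl
    _ = u := by rw [Projective.factorThru_comp]; rfl

end

end FDMod

namespace ModuleFunctor

variable {k : Type u} [Field k] {H : Type u} [Ring H] [Bialgebra k H] [Module.Finite k H]
  {S R : Type u} [Ring S] [Algebra k S] [Ring R] [Algebra k R]
  [LeftComoduleAlgebra k H S] [LeftComoduleAlgebra k H R]
  (G : ModuleFunctor k (FDMod k H) (FDMod k R) (FDMod k S))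

/-- Tensoring with the projective module `H` turns an exact sequence into a split one. Its
image under `F` is thus exact, and it is the image of the sequence under `H ⊗ F(-)`; as `H ⊗ -`
reflects exactness, `F` is right exact. -/
theorem isRightExact_of_exact (hR : IsExactComoduleAlgebra k H R) : FDMod.IsRightExact G.F := by
  intro X Y Z f g hfg hg
  let T := FDMod.reg k H
  have hproj : ∀ M : FDMod k R, Projective (T ⊙ₗ M : FDMod k R) := fun M =>
    hR T M FDMod.projective_reg
  have hfg' : Function.Exact (T ⊴ₗ f).lin (T ⊴ₗ g).lin := lTensor_exact H hfg hg
  have hepi : Epi (T ⊴ₗ g) := FDMod.epi_of_surjective _ (LinearMap.lTensor_surjective H hg)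
  -- `s` is a section of `H ⊗ g`, and `t` lifts the complementary projection along `H ⊗ f`.
  let s : (T ⊙ₗ Z : FDMod k R) ⟶ T ⊙ₗ Y := Projective.factorThru (𝟙 _) (T ⊴ₗ g)
  have hs : s ≫ T ⊴ₗ g = 𝟙 _ := Projective.factorThru_comp _ _
  obtain ⟨t, ht⟩ := FDMod.exists_lift_of_projective (𝟙 _ - (T ⊴ₗ g) ≫ s) (T ⊴ₗ f) (T ⊴ₗ g) hfg'
    (by rw [Preadditive.sub_comp, Category.assoc, hs, Category.comp_id, Category.id_comp, sub_self])
  let σ : (T ⊙ₗ G.F.obj Z : FDMod k S) ⟶ T ⊙ₗ G.F.obj Y := inv (G.c T Z) ≫ G.F.map s ≫ G.c T Y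
  let τ : (T ⊙ₗ G.F.obj Y : FDMod k S) ⟶ T ⊙ₗ G.F.obj X := inv (G.c T Y) ≫ G.F.map t ≫ G.c T X
  have hc : ∀ {V W : FDMod k R} (h : V ⟶ W),
      G.c T V ≫ T ⊴ₗ G.F.map h = G.F.map (T ⊴ₗ h) ≫ G.c T W := fun h =>
    (Functor.OplaxLeftLinear.δₗ_naturality_right G.F T h).symm
  have hσ : σ ≫ T ⊴ₗ G.F.map g = 𝟙 _ := by
    simp only [σ, Category.assoc, hc]
    rw [← G.F.map_comp_assoc, hs, G.F.map_id, Category.id_comp, IsIso.inv_hom_id]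
  have hτ : τ ≫ T ⊴ₗ G.F.map f = 𝟙 _ - (T ⊴ₗ G.F.map g) ≫ σ := by
    have h : (T ⊴ₗ G.F.map g) ≫ σ = inv (G.c T Y) ≫ G.F.map ((T ⊴ₗ g) ≫ s) ≫ G.c T Y := by
      rw [IsIso.eq_inv_comp]
      simp only [σ]
      rw [reassoc_of% (hc g), IsIso.hom_inv_id_assoc, G.F.map_comp, Category.assoc]
    simp only [τ, Category.assoc, hc]
    rw [← G.F.map_comp_assoc, ht, G.F.map_sub, Preadditive.sub_comp, Preadditive.comp_sub, h,
      G.F.map_id, Category.id_comp, IsIso.inv_hom_id]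
  have hτ' : ∀ y : (T ⊙ₗ G.F.obj Y : FDMod k S).V, (T ⊴ₗ G.F.map g).lin y = 0 →
      (T ⊴ₗ G.F.map f).lin (τ.lin y) = y := fun y hy => by
    refine (LinearMap.congr_fun (congrArg FDMod.Hom.lin hτ) y).trans ?_
    show y - σ.lin ((T ⊴ₗ G.F.map g).lin y) = y
    rw [hy, map_zero, sub_zero]
  have : Nontrivial H := (Bialgebra.counitAlgHom k H).toRingHom.domain_nontrivial
  have hsurj : Function.Surjective ((G.F.map g).lin.lTensor H) := fun z =>
    ⟨σ.lin z, LinearMap.congr_fun (congrArg FDMod.Hom.lin hσ) z⟩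
  have hzero : ∀ x, (G.F.map g).lin ((G.F.map f).lin x) = 0 := by
    have h : f ≫ g = 0 := FDMod.hom_ext hfg.linearMap_comp_eq_zero
    have h' : G.F.map f ≫ G.F.map g = 0 := by rw [← G.F.map_comp, h, G.F.map_zero]
    exact LinearMap.congr_fun (congrArg FDMod.Hom.lin h')
  have hexact : Function.Exact ((G.F.map f).lin.lTensor H) ((G.F.map g).lin.lTensor H) := by
    intro y
    constructor
    · exact fun hy => ⟨τ.lin y, hτ' y hy⟩
    · rintro ⟨x, rfl⟩
      have h : (G.F.map g).lin ∘ₗ (G.F.map f).lin = 0 := LinearMap.ext hzero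
      rw [← LinearMap.lTensor_comp_apply, h, LinearMap.lTensor_zero, LinearMap.zero_apply]
  exact ⟨(Module.FaithfullyFlat.lTensor_exact_iff_exact k H _ _).1 hexact,
    (Module.FaithfullyFlat.lTensor_surjective_iff_surjective k H _).1 hsurj⟩

end ModuleFunctor

/-! ### The equivalences -/

/-- `G` is the functor `P ↦ (P ⊗_R -, c)`; `φ` identifies the underlying functors, and through `φ`
the constraint is `c (p ⊗_R (x ⊗ v)) = p₍₋₁₎ x ⊗ (p₍₀₎ ⊗_R v)`. -/
theorem mainTheorem8 (k : Type u) [Field k]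
    (H : Type u) [Ring H] [HopfAlgebra k H] [Module.Finite k H]
    (R : Type u) [Ring R] [Algebra k R] [Module.Finite k R] [LeftComoduleAlgebra k H R]
    (S : Type u) [Ring S] [Algebra k S] [LeftComoduleAlgebra k H S] :
    ∃ (G : EquivariantBimod k H S R ⥤
          ModuleFunctor k (FDMod k H) (FDMod k R) (FDMod k S))
      (φ : G ⋙ ModuleFunctor.forget k (FDMod k H) (FDMod k R) (FDMod k S) ≅
          EquivariantBimod.tensorFunctor k H S R)
      (hG : ∀ P, FDMod.IsRightExact (G.obj P).F),
      (∀ (P : EquivariantBimod k H S R) (X : FDMod k H) (V : FDMod k R)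
          (p : P.V) (x : X.V) (v : V.V),
        (((φ.inv.app P).app (X ⊙ₗ V) ≫ (G.obj P).c X V ≫ X ⊴ₗ (φ.hom.app P).app V).lin
            (P.balMk (X ⊙ₗ V) p (x ⊗ₜ[k] v)) : X.V ⊗[k] P.BalTensor V) = P.twist X V p x v) ∧
      (ObjectProperty.lift (fun F : ModuleFunctor k (FDMod k H) (FDMod k R) (FDMod k S) =>
          FDMod.IsRightExact F.F) G hG).IsEquivalence ∧
      (IsExactComoduleAlgebra k H R → G.IsEquivalence) := by
  let G := EquivariantBimod.tensorModuleFunctor k H S R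
  have hG : ∀ P, FDMod.IsRightExact (G.obj P).F := fun P =>
    EquivariantBimod.isRightExact_tensorFunctor P
  have hess : ∀ F : ModuleFunctor k (FDMod k H) (FDMod k R) (FDMod k S),
      FDMod.IsRightExact F.F → Nonempty (G.obj F.bimod ≅ F) := fun F hF =>
    have := F.isIso_evalHom hF
    ⟨asIso F.evalHom⟩
  refine ⟨G, NatIso.ofComponents (fun P => Iso.refl _) (fun f =>
    (Category.comp_id _).trans (Category.id_comp _).symm), hG, ?_, ?_, ?_⟩
  · intro P X V p x v
    rw [EquivariantBimod.twist_eq]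
    have h : ∀ t : X.V ⊗[k] P.BalTensor V,
        (X ⊴ₗ 𝟙 (P.tensorObj V) : X ⊙ₗ P.tensorObj V ⟶ X ⊙ₗ P.tensorObj V).lin t = t := fun t => by
      rw [MonoidalLeftAction.actionHomRight_id]
      rfl
    exact h _
  · exact
      { essSurj := ⟨fun F => ⟨F.obj.bimod, by
          obtain ⟨e⟩ := hess F.obj F.property
          exact ⟨ObjectProperty.isoMk _ e⟩⟩⟩ }
  · intro hR
    exact { essSurj := ⟨fun F => ⟨F.bimod, hess F (F.isRightExact_of_exact hR)⟩⟩ }
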